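/- Let $\mu$ be Lebesgue measure on $\mathbb R^2$, and let $T:\mathbb R^2\to\mathbb R^2$ be a measurable, $\mu$-preserving map with $T(\mathbf x+\mathbb Z^2)\subset T(\mathbf x)+\mathbb Z^2$ for $\mu$-almost every $\mathbf x$; let $\overline{\mathcal T}=(\overline T,\mathbb R^2/\mathbb Z^2,\overline\mu)$ be the system it induces on the torus with Lebesgue measure. An exchange of $m$ pieces $\mathcal R=(R,D,\mu)$ consists of measurable sets $D_1,\dots,D_m\subset\mathbb R^2$ with $\mu(D_i\cap D_j)=0$ for $i\ne j$ and a map $R:D\to D$, where $D=D_1\cup\dots\cup D_m$. It is *adapted* to $T$ if the system $(R,D,\mu|_D)$ is isomorphic in measure to $\overline{\mathcal T}$; the set of $\mathbf x\in D$ for which some $\mathbf y\in D\setminus\{\mathbf x\}$ satisfies $\mathbf x-\mathbf y\in\mathbb Z^2$ is $\mu$-null; and there are $\mathbf n_1,\dots,\mathbf n_m\in\mathbb Z^2$ with $R(\mathbf x)=T(\mathbf x)-\mathbf n_i$ for all $\mathbf x\in D_i$. For the points $\mathbf x\in D$ each of whose iterates $R^n(\mathbf x)$ lies in exactly one piece,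 the coding $C(\mathbf x)\in\{1,\dots,m\}^{\mathbb N}$ is the sequence whose $n$-th term is the $i$ with $R^n(\mathbf x)\in D_i$. Let $S_{\mathcal R}$ be the set of these codings, $\mu_{\mathcal R}$ the image of $\mu|_D$ under $C$, and $p_{\mathcal R}(n)$ the number of words of length $n$ that are factors of elements of $S_{\mathcal R}$. The exchange $\mathcal R$ is *conjugate* to $T$ (or to $\overline{\mathcal T}$) if it is adapted to $T$ and the shift on $(S_{\mathcal R},\mu_{\mathcal R})$ is isomorphic in measure to $\overline{\mathcal T}$. Finally $$p^{T}(n)=\inf\{p_{\mathcal R}(n) : \mathcal R \text{ an exchange of finitely many pieces conjugate to } T\}.$$ **Theorem.** Let $\phi=(1+\sqrt5)/2$ and $T_\phi(x,y)=\bigl(x+1/\phi^2,\;y+x-1/(2\phi^3)\bigr)$. For every integer $M\ge 0$ there is an exchange of two pieces $\mathcal R_M$ conjugate to $\overline{\mathcal T}_\phi$ such that $p_{\mathcal R_M}(k)=k+1$ for every integer $1\le k\le M$. Moreover $p^{T_\phi}(n)=n+1$ for every integer $n\ge 0$. -/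

import Mathlib

open MeasureTheory Set

namespace PlaneExchange

/-- The plane `ℝ²`; its `volume` is Lebesgue measure. -/
abbrev Plane : Type := ℝ × ℝ

/-- The torus `ℝ²/ℤ²`; its `volume` is Lebesgue (Haar) probability measure. -/
abbrev Torus : Type := UnitAddCircle × UnitAddCircle

/-- The canonical projection `ℝ² → ℝ²/ℤ²`. -/
def toTorus (x : Plane) : Torus := ((x.1 : UnitAddCircle), (x.2 : UnitAddCircle))

/-- The vector of `ℝ²` with the given integer coordinates. -/
def intVec (n : ℤ × ℤ) : Plane := ((n.1 : ℝ), (n.2 : ℝ))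

/-- The representative in `[0,1)²` of a point of the torus. -/
noncomputable def torusRep (p : Torus) : Plane :=
  ((AddCircle.equivIco (1 : ℝ) 0 p.1 : ℝ), (AddCircle.equivIco (1 : ℝ) 0 p.2 : ℝ))

/-- The map of the torus induced by a map `T` of the plane (meaningful when `T` is compatible
with the projection, see `inducedTorusMap_toTorus`). -/
noncomputable def inducedTorusMap (T : Plane → Plane) (p : Torus) : Torus :=
  toTorus (T (torusRep p))

theorem toTorus_torusRep (p : Torus) : toTorus (torusRep p) = p :=
  Prod.ext AddCircle.coe_equivIco AddCircle.coe_equivIco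

/-- If `T (x + ℤ²) ⊆ T x + ℤ²` for all `x`, the induced map is the one that makes the square with
the projection commute. -/
theorem inducedTorusMap_toTorus {T : Plane → Plane}
    (hT : ∀ x y : Plane, toTorus x = toTorus y → toTorus (T x) = toTorus (T y)) (x : Plane) :
    inducedTorusMap T (toTorus x) = toTorus (T x) :=
  hT _ _ (toTorus_torusRep _)

/-- Isomorphism (conjugacy, equivalence) in measure of the dynamical systems `(S, μ)` and
`(T, ν)`: measurable measure-preserving maps in both directions, inverse to each other almost
everywhere, which intertwine `S` and `T` almost everywhere. -/
def MeasureIsomorphic {X Y : Type*} [MeasurableSpace X] [MeasurableSpace Y]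
    (S : X → X) (μ : Measure X) (T : Y → Y) (ν : Measure Y) : Prop :=
  ∃ (f : X → Y) (g : Y → X), MeasurePreserving f μ ν ∧ MeasurePreserving g ν μ ∧
    (∀ᵐ x ∂μ, g (f x) = x) ∧ (∀ᵐ y ∂ν, f (g y) = y) ∧
    (∀ᵐ x ∂μ, f (S x) = T (f x)) ∧ (∀ᵐ y ∂ν, g (T y) = S (g y))

/-- An exchange of `m` pieces of the plane: Lebesgue measurable, almost everywhere pairwise disjoint
pieces `D_i`, and a map `R` that sends the union `D` of the pieces to itself (the values of `R`
outside `D` play no role). -/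
structure PieceExchange (m : ℕ) where
  /-- the pieces `D_i` -/
  piece : Fin m → Set Plane
  /-- the map `R` -/
  map : Plane → Plane
  measurable_piece : ∀ i, NullMeasurableSet (piece i) volume
  disjoint_piece : ∀ i j, i ≠ j → volume (piece i ∩ piece j) = 0
  mapsTo : MapsTo map (⋃ i, piece i) (⋃ i, piece i)

namespace PieceExchange

variable {m : ℕ} (E : PieceExchange m)

/-- The domain `D`, union of the pieces. -/
def domain : Set Plane := ⋃ i, E.piece i

/-- The exchange `E` is adapted to the map `T` of the plane. -/
def AdaptedTo (T : Plane → Plane) : Prop :=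
  MeasureIsomorphic E.map (volume.restrict E.domain) (inducedTorusMap T) volume ∧
  volume {x | x ∈ E.domain ∧ ∃ y ∈ E.domain, y ≠ x ∧ ∃ n : ℤ × ℤ, x - y = intVec n} = 0 ∧
  ∃ n : Fin m → ℤ × ℤ, ∀ i, ∀ x ∈ E.piece i, E.map x = T x - intVec (n i)

/-- The points of `D` that have a well-defined coding: each point of the orbit lies in exactly one
piece. -/
def codable : Set Plane := {x | x ∈ E.domain ∧ ∀ n : ℕ, ∃! i, E.map^[n] x ∈ E.piece i}

/-- The coding `C`: the `n`-th term of `C x` is the `i` such that `R^n x ∈ D_i`. -/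
noncomputable def coding (x : E.codable) : ℕ → Fin m := fun n => (x.2.2 n).choose

/-- The set `S_R` of the sequences that code a point. -/
def codes : Set (ℕ → Fin m) := range E.coding

/-- The image `μ_R` of Lebesgue measure on `D` under the coding. -/
noncomputable def codeMeasure : Measure (ℕ → Fin m) :=
  Measure.map E.coding (Measure.comap Subtype.val (volume : Measure Plane))

/-- The shift on one-sided sequences. -/
def shift (u : ℕ → Fin m) : ℕ → Fin m := fun n => u (n + 1)

/-- The exchange is conjugate to `T`: it is adapted to `T`, and its symbolic dynamical system
(the shift with the measure `μ_R`, carried by `S_R`) is isomorphic in measure to the torus system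
induced by `T`. -/
def ConjugateTo (T : Plane → Plane) : Prop :=
  E.AdaptedTo T ∧ MeasureIsomorphic shift E.codeMeasure (inducedTorusMap T) volume

/-- The language of the exchange: the finite factors of the sequences in `S_R`. -/
def language : Language (Fin m) :=
  {w | ∃ u ∈ E.codes, ∃ j : ℕ, ∀ (i : ℕ) (hi : i < w.length), w[i] = u (j + i)}

/-- The complexity function: the number of words of length `n` of the language. -/
noncomputable def complexity (n : ℕ) : ℕ :=
  Set.ncard {w : List (Fin m) | w ∈ E.language ∧ w.length = n}

end PieceExchange

/-- The complexity function of `T`: the infimum of the complexities at `n` of all exchanges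
(with any finite number of pieces) conjugate to `T`. -/
noncomputable def mapComplexity (T : Plane → Plane) (n : ℕ) : ℕ :=
  sInf {k | ∃ (m : ℕ) (E : PieceExchange m), E.ConjugateTo T ∧ E.complexity n = k}

/-- The map `(x, y) ↦ (x + 1/φ², y + x - 1/(2φ³))`, where `φ` is the golden mean. -/
noncomputable def goldenMap (x : Plane) : Plane :=
  (x.1 + 1 / Real.goldenRatio ^ 2, x.2 + x.1 - 1 / (2 * Real.goldenRatio ^ 3))

/-- The golden map does induce a map of the torus. -/
theorem inducedTorusMap_goldenMap (x : Plane) :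
    inducedTorusMap goldenMap (toTorus x) = toTorus (goldenMap x) := by
  refine inducedTorusMap_toTorus (fun x y h => ?_) x
  simp only [toTorus, Prod.mk.injEq] at h
  simp [toTorus, goldenMap, h.1, h.2]

end PlaneExchange

/-! Lower bound. By Morse and Hedlund (`lt_ncard_factors`), an infinite set of sequences has more
than `n` factors of length `n`. The codes of a conjugate exchange are infinitely many, because the
code measure is isomorphic to Lebesgue measure on the torus and so has no atoms.

Upper bound. Put `α = 1/φ²`. Since `1/(2φ³) = 1/2 - α`, subtracting the same digit `d ∈ {0,1}` from
both coordinates gives `x' = x + α - d` and `y' = y + x' - 1/2`: the second coordinate sums the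
centred first one. Keeping `x` in a fixed unit interval would give a Sturmian coding, which does not
see `y`. Instead, `x` may be raised by 1, but only at visits to a short interval `[-upper, lower)`
given by two consecutive convergents of `α`. The return times there are the denominators `q < q'`,
and between visits the centred sum moves by a bounded amount (`Convergents.excursion_mem`). Raising
`x` once, when needed, brings the sum back into a unit interval at the next visit, so `y` has a
bounded representative that depends only on the torus point (`Convergents.halfRep_map_of_visit`).
This gives an exchange of two pieces.

A word of length `k < q` sees at most one visit among its `k + 1` points, so `x` stays in some unit
interval and the word codes a rotation (`Convergents.exists_shift_mem_Ico`); there are at most `k +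
1` of these (`ncard_le_of_carryWord`). As `q` can be chosen arbitrarily large, both claims follow.

The exchange is conjugate to the map because the coding is injective almost everywhere. Equal
codings make the representatives differ by a constant along the orbits, first in `x`, then in `y`.
By ergodicity (`ergodic_skew`) the supremum of each bounded coordinate along an orbit is almost
surely constant, so these differences vanish (`TorusLift.conjugateTo_goldenMap`). -/

namespace PlaneExchange

/-! ### Factors of sets of sequences: Morse and Hedlund -/

section Factors

variable {α : Type*}

/-- The factors of length `n` of the sequences of a set `S`. -/
def factors (S : Set (ℕ → α)) (n : ℕ) : Set (Fin n → α) :=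
  {w | ∃ u ∈ S, ∃ j : ℕ, ∀ i : Fin n, w i = u (j + i)}

theorem init_mem_factors {S : Set (ℕ → α)} {n : ℕ} {w : Fin (n + 1) → α}
    (hw : w ∈ factors S (n + 1)) : Fin.init w ∈ factors S n := by
  obtain ⟨u, hu, j, h⟩ := hw
  exact ⟨u, hu, j, fun i => h i.castSucc⟩

theorem init_image_factors (S : Set (ℕ → α)) (n : ℕ) :
    Fin.init '' factors S (n + 1) = factors S n := by
  refine Subset.antisymm (image_subset_iff.2 fun w hw => init_mem_factors hw) ?_
  rintro w ⟨u, hu, j, h⟩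
  refine ⟨fun i => u (j + i), ⟨u, hu, j, fun i => rfl⟩, ?_⟩
  funext i
  exact (h i).symm

/-- If every factor of length `n` extends in a unique way to the right, there are finitely many
sequences. -/
theorem finite_of_injOn_init [Finite α] {S : Set (ℕ → α)} {n : ℕ}
    (h : InjOn (Fin.init : (Fin (n + 1) → α) → (Fin n → α)) (factors S (n + 1))) : S.Finite := by
  refine Finite.of_injOn (f := fun (u : ℕ → α) (i : Fin n) => u i) (t := univ)
    (fun _ _ => mem_univ _) ?_ finite_univ
  intro u hu v hv huv
  have key : ∀ j : ℕ, ∀ i < n, u (j + i) = v (j + i) := by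
    intro j
    induction j with
    | zero =>
      intro i hi
      simpa using congrFun huv ⟨i, hi⟩
    | succ j ih =>
      have := h (x₁ := fun i => u (j + i)) ⟨u, hu, j, fun i => rfl⟩
        (x₂ := fun i => v (j + i)) ⟨v, hv, j, fun i => rfl⟩
        (funext fun i => ih i i.2)
      intro i hi
      have := congrFun this ⟨i + 1, by omega⟩
      simpa [add_assoc, add_comm, add_left_comm] using this
  have key2 : ∀ j : ℕ, u (j + n) = v (j + n) := by
    intro j
    have := h (x₁ := fun i => u (j + i)) ⟨u, hu, j, fun i => rfl⟩
      (x₂ := fun i => v (j + i)) ⟨v, hv, j, fun i => rfl⟩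
      (funext fun i => key j i i.2)
    simpa using congrFun this (Fin.last n)
  funext i
  rcases lt_or_ge i n with hi | hi
  · simpa using key 0 i hi
  · simpa [Nat.sub_add_cancel hi] using key2 (i - n)

/-- The theorem of Morse and Hedlund, for a set of sequences. -/
theorem lt_ncard_factors [Finite α] {S : Set (ℕ → α)} (hS : S.Infinite) (n : ℕ) :
    n < (factors S n).ncard := by
  induction n with
  | zero =>
    rw [Set.ncard_pos (toFinite _)]
    obtain ⟨u, hu⟩ := hS.nonempty
    exact ⟨fun i => u i, u, hu, 0, fun i => by simp⟩
  | succ n ih =>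
    refine lt_of_le_of_lt ih ?_
    by_contra hlt
    refine hS (finite_of_injOn_init (n := n) ?_)
    -- Deleting the last letter maps the factors of length `n + 1` onto those of length `n`; if
    -- there are no more of the former, it is injective.
    refine (Set.ncard_image_iff (toFinite _)).1 (le_antisymm (ncard_image_le (toFinite _)) ?_)
    rw [init_image_factors]
    exact not_lt.1 hlt

end Factors

/-! ### The lower bound for every conjugate exchange -/

namespace PieceExchange

variable {m : ℕ} (E : PieceExchange m)

theorem complexity_eq_ncard_factors (n : ℕ) :
    E.complexity n = (factors E.codes n).ncard := by
  rw [complexity, ← ncard_image_of_injective _ (List.ofFn_injective (n := n))]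
  congr 1
  ext w
  constructor
  · rintro ⟨⟨u, hu, j, h⟩, rfl⟩
    exact ⟨fun i => w[i], ⟨u, hu, j, fun i => h i i.2⟩, by simp⟩
  · rintro ⟨v, ⟨u, hu, j, h⟩, rfl⟩
    refine ⟨⟨u, hu, j, fun i hi => ?_⟩, by simp⟩
    simpa using h ⟨i, by simpa using hi⟩

theorem codeMeasure_compl_eq_zero {S : Set (ℕ → Fin m)} (hS : MeasurableSet S)
    (h : E.codes ⊆ S) : E.codeMeasure Sᶜ = 0 := by
  by_cases hc : AEMeasurable E.coding (Measure.comap Subtype.val (volume : Measure Plane))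
  · rw [codeMeasure, Measure.map_apply_of_aemeasurable hc hS.compl]
    convert measure_empty (μ := Measure.comap Subtype.val (volume : Measure Plane))
    refine eq_empty_of_forall_notMem fun x hx => hx (h (mem_range_self x))
  -- The image measure is 0 by convention here.
  · rw [codeMeasure, Measure.map_of_not_aemeasurable hc]
    simp

end PieceExchange

/-- A measure which is isomorphic to one without atoms has no atoms. -/
theorem MeasureIsomorphic.measure_singleton_eq_zero {X Y : Type*} [MeasurableSpace X]
    [MeasurableSpace Y] [MeasurableSingletonClass X] {S : X → X} {μ : Measure X} {T : Y → Y}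
    {ν : Measure Y} [NullSingletonClass ν] (h : MeasureIsomorphic S μ T ν) (x : X) : μ {x} = 0 := by
  obtain ⟨f, g, -, hg, -, hfg, -, -⟩ := h
  rw [← hg.measure_preimage (measurableSet_singleton x).nullMeasurableSet]
  refine measure_mono_null (t := {f x} ∪ {y | f (g y) ≠ y}) ?_
    (measure_union_null (measure_singleton _) hfg)
  intro y hy
  by_cases h : f (g y) = y
  · left
    rw [mem_preimage, mem_singleton_iff] at hy
    rw [mem_singleton_iff, ← hy, h]
  · exact Or.inr h

theorem MeasureIsomorphic.measure_univ_eq {X Y : Type*} [MeasurableSpace X]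
    [MeasurableSpace Y] {S : X → X} {μ : Measure X} {T : Y → Y}
    {ν : Measure Y} (h : MeasureIsomorphic S μ T ν) : μ univ = ν univ := by
  obtain ⟨f, g, -, hg, -, -, -, -⟩ := h
  rw [← hg.measure_preimage MeasurableSet.univ.nullMeasurableSet, preimage_univ]

theorem torus_volume_univ : (volume : Measure Torus) univ = 1 := by
  rw [Measure.volume_eq_prod, ← univ_prod_univ, Measure.prod_prod]
  simp

instance : IsProbabilityMeasure (volume : Measure Torus) := ⟨torus_volume_univ⟩

instance : NullSingletonClass (volume : Measure Torus) := ⟨fun x => by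
  have h : volume ({x.1} : Set UnitAddCircle) = 0 := by
    rw [← Metric.closedBall_zero, AddCircle.volume_closedBall]; simp
  rw [← Prod.mk.eta (p := x), ← singleton_prod_singleton, Measure.volume_eq_prod,
    Measure.prod_prod, h, zero_mul]⟩

/-- A finite set carrying a measure without atoms would have mass 0, but the code measure has mass
1. -/
theorem PieceExchange.ConjugateTo.infinite_codes {m : ℕ} {E : PieceExchange m} {T : Plane → Plane}
    (h : E.ConjugateTo T) : E.codes.Infinite := by
  intro hfin
  have h1 : E.codeMeasure univ = 1 := h.2.measure_univ_eq.trans torus_volume_univ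
  have h2 : E.codeMeasure E.codesᶜ = 0 :=
    E.codeMeasure_compl_eq_zero hfin.measurableSet Subset.rfl
  have h3 : E.codeMeasure E.codes = 0 := by
    rw [← biUnion_of_singleton E.codes, measure_biUnion_null_iff hfin.countable]
    exact fun x _ => h.2.measure_singleton_eq_zero x
  have h4 := measure_union_null h3 h2
  rw [union_compl_self, h1] at h4
  exact one_ne_zero h4

theorem PieceExchange.ConjugateTo.lt_complexity {m : ℕ} {E : PieceExchange m} {T : Plane → Plane}
    (h : E.ConjugateTo T) (n : ℕ) : n < E.complexity n := by
  rw [E.complexity_eq_ncard_factors]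
  exact lt_ncard_factors h.infinite_codes n


/-! ### Ergodicity of skew translations, by Fourier coefficients -/

/-- The skew translation `(x, y) ↦ (x + a, y + x - c)` of the torus. -/
def skew (a c : UnitAddCircle) (p : Torus) : Torus := (p.1 + a, p.2 + p.1 - c)

theorem measurable_skew (a c : UnitAddCircle) : Measurable (skew a c) := by
  unfold skew; fun_prop

theorem measurePreserving_skew (a c : UnitAddCircle) : MeasurePreserving (skew a c) := by
  refine MeasurePreserving.skew_product (g := fun x y => y + x - c)
    (measurePreserving_add_right volume a) (by unfold Function.uncurry; fun_prop) ?_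
  refine Filter.Eventually.of_forall fun x => ?_
  simp_rw [add_sub_assoc]
  exact (measurePreserving_add_right volume (x - c)).map_eq

/-- The characters of the torus. -/
noncomputable def torusChar (m k : ℤ) : C(Torus, ℂ) :=
  (fourier m).comp ContinuousMap.fst * (fourier k).comp ContinuousMap.snd

theorem torusChar_apply (m k : ℤ) (p : Torus) :
    torusChar m k p = fourier m p.1 * fourier k p.2 := rfl

theorem torusChar_mul (m k m' k' : ℤ) :
    torusChar m k * torusChar m' k' = torusChar (m + m') (k + k') := by
  ext p
  rw [ContinuousMap.mul_apply, torusChar_apply, torusChar_apply, torusChar_apply, fourier_add,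
    fourier_add]
  ring

theorem star_torusChar (m k : ℤ) : star (torusChar m k) = torusChar (-m) (-k) := by
  ext p
  rw [ContinuousMap.star_apply, torusChar_apply, torusChar_apply, fourier_neg, fourier_neg]
  simp

theorem fourier_translate (n : ℤ) (x y : UnitAddCircle) :
    fourier n (x + y) = fourier n x * fourier n y := by
  rw [fourier_apply, smul_add, AddCircle.toCircle_add, Circle.coe_mul]; rfl

theorem norm_fourier_apply (n : ℤ) (x : UnitAddCircle) : ‖(fourier n x : ℂ)‖ = 1 :=
  Circle.norm_coe _

theorem torusChar_skew (a c : UnitAddCircle) (m k : ℤ) (p : Torus) :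
    torusChar m k (skew a c p) = fourier m a * fourier k (-c) * torusChar (m + k) k p := by
  simp only [torusChar_apply, skew, sub_eq_add_neg, fourier_translate, fourier_add]
  ring

theorem setIntegral_torusChar_of_invariant {a c : UnitAddCircle} {A : Set Torus}
    (hA : MeasurableSet A) (h : skew a c ⁻¹' A = A) (m k : ℤ) :
    ∫ p in A, torusChar m k p =
      fourier m a * fourier k (-c) * ∫ p in A, torusChar (m + k) k p := by
  have hmp := (measurePreserving_skew a c).restrict_preimage hA
  rw [← integral_const_mul]
  conv_lhs => rw [← hmp.map_eq]
  rw [integral_map hmp.measurable.aemeasurable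
    (torusChar m k).continuous.aestronglyMeasurable, h]
  simp_rw [torusChar_skew]

theorem integral_fourier_eq_zero {n : ℤ} (hn : n ≠ 0) :
    ∫ x : UnitAddCircle, (fourier n x : ℂ) = 0 :=
  integral_eq_zero_of_add_right_eq_neg (fourier_add_half_inv_index hn one_pos)

theorem integral_torusChar_zero {m : ℤ} (hm : m ≠ 0) : ∫ p : Torus, torusChar m 0 p = 0 := by
  simp_rw [torusChar_apply]
  rw [Measure.volume_eq_prod, integral_prod_mul (fun x : UnitAddCircle => (fourier m x : ℂ))
    (fun x : UnitAddCircle => (fourier 0 x : ℂ)), integral_fourier_eq_zero hm, zero_mul]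

theorem torusChar_zero_zero : torusChar 0 0 = 1 := by
  ext p
  rw [torusChar_apply, fourier_zero, fourier_zero, one_mul, ContinuousMap.one_apply]

theorem orthonormal_torusChar {m k : ℤ} (hk : k ≠ 0) :
    Orthonormal ℂ fun j : ℕ =>
      ContinuousMap.toLp (E := ℂ) 2 (volume : Measure Torus) ℂ (torusChar (m + j * k) k) := by
  rw [orthonormal_iff_ite]
  intro i j
  rw [ContinuousMap.inner_toLp]
  have : ∀ p : Torus, torusChar (m + j * k) k p *
      (starRingEnd ℂ) (torusChar (m + i * k) k p) = torusChar ((j - i) * k) 0 p := by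
    intro p
    have h1 : (starRingEnd ℂ) (torusChar (m + i * k) k p) = star (torusChar (m + i * k) k) p := rfl
    rw [h1, star_torusChar, ← ContinuousMap.mul_apply, torusChar_mul]
    congr 2 <;> ring
  simp_rw [this]
  split_ifs with hij
  · simp [hij, torusChar_zero_zero]
  · exact integral_torusChar_zero (mul_ne_zero (by omega) hk)

/-- For `k = 0` invariance multiplies the coefficient by `fourier m a ≠ 1`. For `k ≠ 0` it shows
that all coefficients of index `(m + j k, k)` have the same modulus, which Bessel's inequality for
the indicator of `A` allows only if it is 0. -/
theorem setIntegral_torusChar_eq_zero {a c : UnitAddCircle} (ha : ∀ n : ℤ, n ≠ 0 → n • a ≠ 0)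
    {A : Set Torus} (hA : MeasurableSet A) (h : skew a c ⁻¹' A = A) {m k : ℤ}
    (hmk : m ≠ 0 ∨ k ≠ 0) : ∫ p in A, torusChar m k p = 0 := by
  by_cases hk : k = 0
  · subst hk
    have hm : m ≠ 0 := by simpa using hmk
    have h1 := setIntegral_torusChar_of_invariant hA h m 0
    rw [fourier_zero, mul_one, add_zero] at h1
    have h2 : (fourier m a : ℂ) ≠ 1 := by
      intro h2
      rw [fourier_apply] at h2
      refine ha m hm (AddCircle.injective_toCircle one_ne_zero ?_)
      rw [AddCircle.toCircle_zero]
      exact Circle.ext (h2.trans Circle.coe_one.symm)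
    have h3 : (1 - (fourier m a : ℂ)) * ∫ p in A, torusChar m 0 p = 0 := by
      rw [sub_mul, one_mul, sub_eq_zero]; exact h1
    exact (mul_eq_zero.1 h3).resolve_left (sub_ne_zero.2 h2.symm)
  · have hconst : ∀ j : ℕ, ‖∫ p in A, torusChar (m + j * k) k p‖ = ‖∫ p in A, torusChar m k p‖ := by
      intro j
      induction j with
      | zero => simp
      | succ j ih =>
        rw [← ih, setIntegral_torusChar_of_invariant hA h (m + j * k) k, norm_mul, norm_mul,
          norm_fourier_apply, norm_fourier_apply, one_mul, one_mul]
        have : m + (j : ℤ) * k + k = m + ((j + 1 : ℕ) : ℤ) * k := by push_cast; ring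
        rw [this]
    have hs := (orthonormal_torusChar (m := m) hk).inner_products_summable
      (indicatorConstLp 2 hA (measure_ne_top volume A) (1 : ℂ))
    have hc : ∀ j : ℕ, ‖inner ℂ (ContinuousMap.toLp (E := ℂ) 2 (volume : Measure Torus) ℂ
        (torusChar (m + j * k) k)) (indicatorConstLp 2 hA (measure_ne_top volume A) (1 : ℂ))‖ ^ 2 =
        ‖∫ p in A, torusChar m k p‖ ^ 2 := by
      intro j
      rw [← hconst j, norm_inner_symm, L2.inner_indicatorConstLp_one]
      congr 2
      exact setIntegral_congr_ae hA
        ((ContinuousMap.coeFn_toLp volume (torusChar (m + j * k) k)).mono fun _ h _ => h)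
    simp_rw [hc] at hs
    have := (summable_const_iff _).1 hs
    simpa using this

/-- The bounded continuous functions on the torus generated by the characters. -/
noncomputable def torusCharSubalgebra :
    StarSubalgebra ℂ (BoundedContinuousFunction Torus ℂ) where
  toSubalgebra := Algebra.adjoin ℂ
    (range fun n : ℤ × ℤ => BoundedContinuousFunction.mkOfCompact (torusChar n.1 n.2))
  star_mem' := by
    change Algebra.adjoin ℂ _ ≤ star (Algebra.adjoin ℂ _)
    refine Algebra.adjoin_le ?_
    rintro - ⟨n, rfl⟩
    refine Algebra.subset_adjoin ⟨-n, ?_⟩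
    ext p
    exact (DFunLike.congr_fun (star_torusChar n.1 n.2) p).symm

theorem torusCharSubalgebra_eq_span :
    Subalgebra.toSubmodule torusCharSubalgebra.toSubalgebra = Submodule.span ℂ
      (range fun n : ℤ × ℤ => BoundedContinuousFunction.mkOfCompact (torusChar n.1 n.2)) := by
  refine Algebra.adjoin_eq_span_of_subset _ (Subset.trans ?_ Submodule.subset_span)
  intro x hx
  refine Submonoid.closure_induction (fun _ => id) ⟨0, ?_⟩ ?_ hx
  · ext p
    exact DFunLike.congr_fun torusChar_zero_zero p
  · rintro - - - - ⟨m, rfl⟩ ⟨n, rfl⟩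
    refine ⟨m + n, ?_⟩
    ext p
    exact (DFunLike.congr_fun (torusChar_mul m.1 m.2 n.1 n.2) p).symm

theorem torusCharSubalgebra_separatesPoints :
    (torusCharSubalgebra.map
      (BoundedContinuousFunction.toContinuousMapStarₐ ℂ)).SeparatesPoints := by
  intro x y hxy
  have hmem : ∀ m k : ℤ, torusChar m k ∈ torusCharSubalgebra.map
      (BoundedContinuousFunction.toContinuousMapStarₐ ℂ) := fun m k =>
    ⟨BoundedContinuousFunction.mkOfCompact (torusChar m k),
      Algebra.subset_adjoin ⟨(m, k), rfl⟩, rfl⟩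
  by_cases h1 : x.1 = y.1
  · refine ⟨_, ⟨torusChar 0 1, hmem 0 1, rfl⟩, fun h => hxy (Prod.ext h1 ?_)⟩
    simp only [torusChar_apply, fourier_zero, one_mul, fourier_one] at h
    exact AddCircle.injective_toCircle one_ne_zero (Subtype.coe_inj.1 h)
  · refine ⟨_, ⟨torusChar 1 0, hmem 1 0, rfl⟩, fun h => h1 ?_⟩
    simp only [torusChar_apply, fourier_zero, mul_one, fourier_one] at h
    exact AddCircle.injective_toCircle one_ne_zero (Subtype.coe_inj.1 h)

/-- A finite measure on the torus is determined by its Fourier coefficients. -/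
theorem ext_of_integral_torusChar_eq {μ ν : Measure Torus} [IsFiniteMeasure μ] [IsFiniteMeasure ν]
    (h : ∀ m k : ℤ, ∫ p, torusChar m k p ∂μ = ∫ p, torusChar m k p ∂ν) : μ = ν := by
  refine ext_of_forall_mem_subalgebra_integral_eq_of_polish (𝕜 := ℂ)
    torusCharSubalgebra_separatesPoints fun g hg => ?_
  have hg' : g ∈ Subalgebra.toSubmodule torusCharSubalgebra.toSubalgebra := hg
  rw [torusCharSubalgebra_eq_span] at hg'
  induction hg' using Submodule.span_induction with
  | mem x hx =>
    obtain ⟨n, rfl⟩ := hx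
    exact h n.1 n.2
  | zero => simp
  | add x y hx hy ihx ihy =>
    simp only [BoundedContinuousFunction.add_apply]
    rw [integral_add (x.integrable _) (y.integrable _), integral_add (x.integrable _)
      (y.integrable _), ihx (by rw [← torusCharSubalgebra_eq_span] at hx; exact hx),
      ihy (by rw [← torusCharSubalgebra_eq_span] at hy; exact hy)]
  | smul r x hx ih =>
    simp only [BoundedContinuousFunction.smul_apply]
    rw [integral_smul, integral_smul, ih (by rw [← torusCharSubalgebra_eq_span] at hx; exact hx)]

/-- A skew translation of the torus over an irrational rotation is ergodic. -/
theorem ergodic_skew {a c : UnitAddCircle} (ha : ∀ n : ℤ, n ≠ 0 → n • a ≠ 0) :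
    Ergodic (skew a c) := by
  refine ⟨measurePreserving_skew a c, ⟨fun A hA h => ?_⟩⟩
  -- Both sides have the same Fourier coefficients; evaluating at `Aᶜ` then gives `volume A * volume
  -- Aᶜ = 0`.
  have key : (volume : Measure Torus).restrict A = volume A • volume := by
    have : IsFiniteMeasure (volume A • (volume : Measure Torus)) :=
      Measure.smul_finite _ (measure_ne_top _ _)
    refine ext_of_integral_torusChar_eq fun m k => ?_
    by_cases hmk : m ≠ 0 ∨ k ≠ 0
    · rw [setIntegral_torusChar_eq_zero ha hA h hmk, integral_smul_measure,
        ← setIntegral_univ, setIntegral_torusChar_eq_zero ha (c := c) MeasurableSet.univ rfl hmk,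
        smul_zero]
    · push Not at hmk
      rw [hmk.1, hmk.2, torusChar_zero_zero]
      simp [Measure.real]
  have h2 := congrArg (fun μ : Measure Torus => μ Aᶜ) key
  simp only [Measure.restrict_apply hA.compl, compl_inter_self, measure_empty, Measure.smul_apply,
    smul_eq_mul] at h2
  rw [Filter.eventuallyConst_set']
  rcases mul_eq_zero.1 h2.symm with h0 | h0
  · exact Or.inl (ae_eq_empty.2 h0)
  · exact Or.inr (ae_eq_univ.2 h0)


/-! ### From representatives on the torus to exchanges of the plane -/

theorem measurable_toTorus : Measurable toTorus := by
  unfold toTorus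
  exact (AddCircle.measurable_mk'.comp measurable_fst).prodMk
    (AddCircle.measurable_mk'.comp measurable_snd)

theorem unitAddCircle_coe_eq_coe_iff {x y : ℝ} :
    (x : UnitAddCircle) = y ↔ ∃ n : ℤ, x - y = n := by
  rw [← sub_eq_zero, ← AddCircle.coe_sub, AddCircle.coe_eq_zero_iff]
  simp [eq_comm]

theorem toTorus_eq_toTorus_iff {x y : Plane} :
    toTorus x = toTorus y ↔ ∃ n : ℤ × ℤ, x - y = intVec n := by
  simp only [toTorus, unitAddCircle_coe_eq_coe_iff, intVec, Prod.ext_iff,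
    Prod.fst_sub, Prod.snd_sub, Prod.exists, exists_and_left, exists_and_right]

/-- The lattice `ℤ²` of the plane. -/
def intLattice : AddSubgroup Plane :=
  AddMonoidHom.range
    { toFun := intVec
      map_zero' := by simp [intVec]
      map_add' := fun a b => by simp [intVec] }

instance : Countable intLattice := by
  have : (intLattice : Set Plane) = range intVec := rfl
  exact (this ▸ countable_range intVec : (intLattice : Set Plane).Countable).to_subtype

/-- A set of representatives of `ℝ²/ℤ²` is a fundamental domain of `ℤ²`. -/
theorem isAddFundamentalDomain_of_bijOn {D : Set Plane} (hD : MeasurableSet D)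
    (h : BijOn toTorus D univ) : IsAddFundamentalDomain intLattice D volume := by
  refine IsAddFundamentalDomain.mk' hD.nullMeasurableSet fun x => ?_
  obtain ⟨y, hy, hxy⟩ := h.surjOn (mem_univ (toTorus x))
  obtain ⟨n, hn⟩ := toTorus_eq_toTorus_iff.1 hxy
  refine ⟨⟨y - x, ⟨n, hn.symm⟩⟩, ?_, ?_⟩
  · change y - x + x ∈ D
    rwa [sub_add_cancel]
  · rintro ⟨g, ⟨k, rfl⟩⟩ hg
    change intVec k + x ∈ D at hg
    refine Subtype.ext ?_
    change intVec k = y - x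
    rw [eq_sub_iff_add_eq]
    refine h.injOn hg hy ?_
    rw [hxy]
    exact toTorus_eq_toTorus_iff.2 ⟨k, by simp⟩

theorem bijOn_toTorus_unitSquare : BijOn toTorus (Ioc 0 (0 + 1) ×ˢ Ioc 0 (0 + 1)) univ := by
  refine ⟨fun _ _ => mem_univ _, fun x hx y hy h => ?_, fun z _ => ?_⟩
  · simp only [toTorus, Prod.mk.injEq] at h
    exact Prod.ext ((AddCircle.coe_eq_coe_iff_of_mem_Ioc hx.1 hy.1).1 h.1)
      ((AddCircle.coe_eq_coe_iff_of_mem_Ioc hx.2 hy.2).1 h.2)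
  · exact ⟨((AddCircle.equivIoc (1 : ℝ) 0 z.1 : ℝ), (AddCircle.equivIoc (1 : ℝ) 0 z.2 : ℝ)),
      ⟨Subtype.coe_prop _, Subtype.coe_prop _⟩,
      Prod.ext AddCircle.coe_equivIoc AddCircle.coe_equivIoc⟩

theorem measurePreserving_toTorus_unitSquare :
    MeasurePreserving toTorus (volume.restrict (Ioc 0 (0 + 1) ×ˢ Ioc 0 (0 + 1))) volume := by
  have h := (UnitAddCircle.measurePreserving_mk 0).prod (UnitAddCircle.measurePreserving_mk 0)
  rw [Measure.prod_restrict] at h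
  exact h

/-- On a set of representatives the projection preserves the measure. -/
theorem measurePreserving_toTorus {D : Set Plane} (hD : MeasurableSet D)
    (h : BijOn toTorus D univ) : MeasurePreserving toTorus (volume.restrict D) volume := by
  refine ⟨measurable_toTorus, ?_⟩
  ext A hA
  have hA' := measurable_toTorus hA
  rw [Measure.map_apply measurable_toTorus hA, Measure.restrict_apply hA',
    ← measurePreserving_toTorus_unitSquare.measure_preimage hA.nullMeasurableSet,
    Measure.restrict_apply hA']
  -- Two fundamental domains meet the lattice-invariant preimage of `A` in sets of equal measure.
  refine (isAddFundamentalDomain_of_bijOn hD h).measure_set_eq (isAddFundamentalDomain_of_bijOn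
    (measurableSet_Ioc.prod measurableSet_Ioc) bijOn_toTorus_unitSquare) hA' ?_
  rintro ⟨g, ⟨k, rfl⟩⟩
  ext x
  change toTorus (intVec k + x) ∈ A ↔ toTorus x ∈ A
  rw [show toTorus (intVec k + x) = toTorus x from toTorus_eq_toTorus_iff.2 ⟨k, by simp⟩]

/-- A measurable choice of representatives in the plane of the points of the torus, for which `T`
becomes an exchange of `m` pieces, the pieces being the level sets of `digit`. -/
structure TorusLift (T : Plane → Plane) (m : ℕ) where
  /-- the representative -/
  rep : Torus → Plane
  /-- the index of the piece -/
  digit : Torus → Fin m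
  /-- the translations -/
  vec : Fin m → ℤ × ℤ
  measurable_rep : Measurable rep
  measurable_digit : Measurable digit
  toTorus_rep : ∀ z, toTorus (rep z) = z
  rep_step : ∀ z, rep (inducedTorusMap T z) = T (rep z) - intVec (vec (digit z))

namespace TorusLift

variable {T : Plane → Plane} {m : ℕ} (L : TorusLift T m)

/-- The set of the representatives. -/
def domain : Set Plane := {x | L.rep (toTorus x) = x}

theorem rep_mem_domain (z : Torus) : L.rep z ∈ L.domain := by
  rw [domain, mem_ofPred_eq, L.toTorus_rep]

theorem measurableSet_domain : MeasurableSet L.domain :=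
  measurableSet_eq_fun (L.measurable_rep.comp measurable_toTorus) measurable_id

theorem bijOn_domain : BijOn toTorus L.domain univ :=
  ⟨fun _ _ => mem_univ _, fun x hx y hy h => by rw [← hx, ← hy, h],
    fun z _ => ⟨L.rep z, L.rep_mem_domain z, L.toTorus_rep z⟩⟩

theorem measurePreserving_toTorus_domain :
    MeasurePreserving toTorus (volume.restrict L.domain) volume :=
  measurePreserving_toTorus L.measurableSet_domain L.bijOn_domain

theorem ae_rep_toTorus : ∀ᵐ x ∂(volume.restrict L.domain), L.rep (toTorus x) = x :=
  ae_restrict_mem L.measurableSet_domain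

theorem measurePreserving_rep : MeasurePreserving L.rep volume (volume.restrict L.domain) := by
  refine ⟨L.measurable_rep, ?_⟩
  rw [← L.measurePreserving_toTorus_domain.map_eq, Measure.map_map L.measurable_rep
    measurable_toTorus]
  conv_rhs => rw [← Measure.map_id (μ := volume.restrict L.domain)]
  exact Measure.map_congr L.ae_rep_toTorus

/-- The exchange of pieces defined by a lift. -/
def exchange : PieceExchange m where
  piece i := {x | L.rep (toTorus x) = x ∧ L.digit (toTorus x) = i}
  map x := T x - intVec (L.vec (L.digit (toTorus x)))
  measurable_piece i := (L.measurableSet_domain.inter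
    ((L.measurable_digit.comp measurable_toTorus) (measurableSet_singleton i))).nullMeasurableSet
  disjoint_piece i j hij := by
    convert measure_empty (μ := (volume : Measure Plane))
    exact eq_empty_of_forall_notMem fun x hx => hij (hx.1.2.symm.trans hx.2.2)
  mapsTo := by
    intro x hx
    obtain ⟨i, hx, -⟩ := mem_iUnion.1 hx
    have h := L.rep_step (toTorus x)
    rw [hx] at h
    beta_reduce
    rw [← h]
    exact mem_iUnion.2 ⟨_, L.rep_mem_domain _, rfl⟩

theorem exchange_domain : L.exchange.domain = L.domain := by
  ext x
  simp [PieceExchange.domain, exchange, domain]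

theorem exchange_map_rep (z : Torus) :
    L.exchange.map (L.rep z) = L.rep (inducedTorusMap T z) := by
  rw [L.rep_step z]
  simp [exchange, L.toTorus_rep]

theorem exchange_map_of_mem {x : Plane} (hx : x ∈ L.domain) :
    L.exchange.map x = L.rep (inducedTorusMap T (toTorus x)) := by
  rw [← L.exchange_map_rep, show L.rep (toTorus x) = x from hx]

theorem exchange_adaptedTo : L.exchange.AdaptedTo T := by
  refine ⟨⟨toTorus, L.rep, ?_, ?_, ?_, ?_, ?_, ?_⟩, ?_, L.vec, ?_⟩
  · rw [exchange_domain]; exact L.measurePreserving_toTorus_domain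
  · rw [exchange_domain]; exact L.measurePreserving_rep
  · rw [exchange_domain]; exact L.ae_rep_toTorus
  · exact Filter.Eventually.of_forall L.toTorus_rep
  · rw [exchange_domain]
    filter_upwards [ae_restrict_mem L.measurableSet_domain] with x hx
    rw [L.exchange_map_of_mem hx, L.toTorus_rep]
  · exact Filter.Eventually.of_forall fun z => (L.exchange_map_rep z).symm
  · convert measure_empty (μ := (volume : Measure Plane))
    refine eq_empty_of_forall_notMem ?_
    rintro x ⟨hx, y, hy, hyx, n, hn⟩
    rw [exchange_domain] at hx hy
    exact hyx (L.bijOn_domain.injOn hy hx (toTorus_eq_toTorus_iff.2 ⟨n, hn⟩).symm)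
  · rintro i x ⟨-, rfl⟩
    rfl

theorem exchange_iterate_rep (n : ℕ) (z : Torus) :
    L.exchange.map^[n] (L.rep z) = L.rep ((inducedTorusMap T)^[n] z) := by
  induction n generalizing z with
  | zero => rfl
  | succ n ih => rw [Function.iterate_succ_apply, exchange_map_rep, ih,
      Function.iterate_succ_apply]

theorem rep_mem_piece_iff (z : Torus) (i : Fin m) :
    L.rep z ∈ L.exchange.piece i ↔ L.digit z = i := by
  simp [exchange, L.toTorus_rep]

theorem exchange_codable : L.exchange.codable = L.domain := by
  ext x
  refine ⟨fun h => L.exchange_domain ▸ h.1, fun hx => ⟨L.exchange_domain.symm ▸ hx, fun n => ?_⟩⟩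
  rw [← show L.rep (toTorus x) = x from hx]
  simp [exchange_iterate_rep, rep_mem_piece_iff]

/-- The coding of the orbits on the torus. -/
noncomputable def torusCoding (z : Torus) (n : ℕ) : Fin m := L.digit ((inducedTorusMap T)^[n] z)

theorem exchange_coding (x : L.exchange.codable) :
    L.exchange.coding x = L.torusCoding (toTorus x) := by
  funext n
  have h : L.exchange.map^[n] x ∈ L.exchange.piece (L.exchange.coding x n) :=
    (x.2.2 n).choose_spec.1
  have hx : L.rep (toTorus x) = x := (L.exchange_codable ▸ x.2 : (x : Plane) ∈ L.domain)
  generalize L.exchange.coding x n = i at h ⊢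
  rw [← hx, exchange_iterate_rep, rep_mem_piece_iff] at h
  exact h.symm

theorem exchange_codes : L.exchange.codes = range L.torusCoding := by
  ext u
  constructor
  · rintro ⟨x, rfl⟩
    exact ⟨_, (L.exchange_coding x).symm⟩
  · rintro ⟨z, rfl⟩
    refine ⟨⟨L.rep z, L.exchange_codable.symm ▸ L.rep_mem_domain z⟩, ?_⟩
    rw [exchange_coding, L.toTorus_rep]

theorem measurable_torusCoding (hT : Measurable (inducedTorusMap T)) :
    Measurable L.torusCoding :=
  measurable_pi_lambda _ fun n => L.measurable_digit.comp (hT.iterate n)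

theorem exchange_codeMeasure (hT : Measurable (inducedTorusMap T)) :
    L.exchange.codeMeasure = (volume : Measure Torus).map L.torusCoding := by
  have h1 : L.exchange.coding = L.torusCoding ∘ toTorus ∘ Subtype.val := by
    funext x
    exact L.exchange_coding x
  have hc : MeasurableSet L.exchange.codable := L.exchange_codable ▸ L.measurableSet_domain
  rw [PieceExchange.codeMeasure, h1, ← Measure.map_map (L.measurable_torusCoding hT)
    (measurable_toTorus.comp measurable_subtype_coe), ← Measure.map_map measurable_toTorus
    measurable_subtype_coe, map_comap_subtype_coe hc, exchange_codable,
    L.measurePreserving_toTorus_domain.map_eq]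

theorem shift_torusCoding (z : Torus) :
    PieceExchange.shift (L.torusCoding z) = L.torusCoding (inducedTorusMap T z) := rfl

/-- If almost every point is determined by its coding, the exchange is conjugate to `T`. -/
theorem exchange_conjugateTo (hT : MeasurePreserving (inducedTorusMap T)) {Z : Set Torus}
    (hZ : MeasurableSet Z) (hZ' : ∀ᵐ z, z ∈ Z) (hinj : InjOn L.torusCoding Z) :
    L.exchange.ConjugateTo T := by
  refine ⟨L.exchange_adaptedTo, ?_⟩
  have hc := L.measurable_torusCoding hT.measurable
  rw [L.exchange_codeMeasure hT.measurable]
  have : StandardBorelSpace Z := hZ.standardBorel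
  -- Lusin–Souslin: an injective measurable map on a standard Borel space has a measurable inverse,
  -- which is then extended to all sequences.
  have hemb : MeasurableEmbedding (fun z : Z => L.torusCoding z) :=
    (hc.comp measurable_subtype_coe).measurableEmbedding fun x y h =>
      Subtype.ext (hinj x.2 y.2 h)
  obtain ⟨f, hf, hfc⟩ := hemb.exists_measurable_extend (measurable_subtype_coe (p := (· ∈ Z)))
    fun _ => ⟨0⟩
  have hfZ : ∀ z ∈ Z, f (L.torusCoding z) = z := fun z hz => congrFun hfc ⟨z, hz⟩
  have hae : ∀ᵐ z : Torus, f (L.torusCoding z) = z := hZ'.mono hfZ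
  have hae' : ∀ᵐ z : Torus, f (L.torusCoding (inducedTorusMap T z)) = inducedTorusMap T z :=
    hT.quasiMeasurePreserving.ae hae
  refine ⟨f, L.torusCoding, ⟨hf, ?_⟩, ⟨hc, rfl⟩, ?_, hae, ?_, ?_⟩
  · rw [Measure.map_map hf hc]
    conv_rhs => rw [← Measure.map_id (μ := (volume : Measure Torus))]
    exact Measure.map_congr hae
  · refine (ae_map_iff hc.aemeasurable (measurableSet_eq_fun (hc.comp hf) measurable_id)).2 ?_
    exact hae.mono fun z hz => congrArg L.torusCoding hz
  · have hs : Measurable (PieceExchange.shift (m := m)) :=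
      measurable_pi_lambda _ fun n => measurable_pi_apply _
    refine (ae_map_iff hc.aemeasurable
      (measurableSet_eq_fun (hf.comp hs) (hT.measurable.comp hf))).2 ?_
    filter_upwards [hae, hae'] with z hz hz'
    change f (PieceExchange.shift (L.torusCoding z)) = inducedTorusMap T (f (L.torusCoding z))
    rw [hz, shift_torusCoding, hz']
  · exact Filter.Eventually.of_forall fun z => rfl

end TorusLift

/-! ### Recovering a point from its coding -/

/-- The supremum along orbits of a measurable function bounded above is almost surely constant. -/
theorem exists_ae_iSup_iterate_eq {f : Torus → Torus} (hf : Ergodic f) {g : Torus → ℝ}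
    (hg : Measurable g) {C : ℝ} (hC : ∀ z, g z ≤ C) :
    ∃ s : ℝ, ∀ᵐ z, ⨆ n : ℕ, g (f^[n] z) = s := by
  have hbdd : ∀ z, BddAbove (range fun n : ℕ => g (f^[n] z)) := fun z =>
    ⟨C, by rintro _ ⟨n, rfl⟩; exact hC _⟩
  have hh : Measurable fun z => ⨆ n : ℕ, g (f^[n] z) :=
    Measurable.iSup fun n => hg.comp (hf.measurable.iterate n)
  have hle : ∀ z, ⨆ n : ℕ, g (f^[n] (f z)) ≤ ⨆ n : ℕ, g (f^[n] z) := fun z =>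
    ciSup_le fun n => le_ciSup (hbdd z) (n + 1)
  -- The supremum can only decrease along an orbit, so its superlevel sets contain their preimages
  -- and are trivial by ergodicity; rational levels suffice.
  have hdich : ∀ r : ℚ, ∃ b : Prop, ∀ᵐ z, ((r : ℝ) < ⨆ n : ℕ, g (f^[n] z)) ↔ b := by
    intro r
    rcases hf.ae_empty_or_univ_of_preimage_ae_le (s := {z | (r : ℝ) < ⨆ n : ℕ, g (f^[n] z)})
      (measurableSet_lt measurable_const hh).nullMeasurableSet
      (Filter.Eventually.of_forall fun z (hz : (r : ℝ) < _) => lt_of_lt_of_le hz (hle z)) with h | h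
    · exact ⟨False, by
        filter_upwards [h] with z hz
        exact ⟨fun h' => hz.mp h', False.elim⟩⟩
    · exact ⟨True, by
        filter_upwards [h] with z hz
        exact ⟨fun _ => trivial, fun _ => hz.mpr trivial⟩⟩
  choose b hb using hdich
  have hall : ∀ᵐ z, ∀ r : ℚ, ((r : ℝ) < ⨆ n : ℕ, g (f^[n] z)) ↔ b r := ae_all_iff.2 hb
  obtain ⟨z₀, hz₀⟩ := hall.exists
  refine ⟨⨆ n : ℕ, g (f^[n] z₀), hall.mono fun z hz => ?_⟩
  rcases lt_trichotomy (⨆ n : ℕ, g (f^[n] z)) (⨆ n : ℕ, g (f^[n] z₀)) with h | h | h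
  · obtain ⟨r, hr1, hr2⟩ := exists_rat_btwn h
    exact absurd ((hz r).2 ((hz₀ r).1 hr2)) (not_lt.2 hr1.le)
  · exact h
  · obtain ⟨r, hr1, hr2⟩ := exists_rat_btwn h
    exact absurd ((hz₀ r).2 ((hz r).1 hr2)) (not_lt.2 hr1.le)

/-- Boundedness matters: the supremum of an unbounded real family is 0 by convention, whatever `d`
is. -/
theorem eq_zero_of_iSup_add_eq {g : ℕ → ℝ} (hg : BddAbove (range g)) {d : ℝ}
    (h : ⨆ n, (g n + d) = ⨆ n, g n) : d = 0 := by
  rw [← ciSup_add hg] at h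
  linarith


theorem inv_goldenRatio_sq : 1 / Real.goldenRatio ^ 2 = 2 - Real.goldenRatio := by
  rw [div_eq_iff (pow_ne_zero _ Real.goldenRatio_ne_zero)]
  linear_combination (Real.goldenRatio - 1) * Real.goldenRatio_sq

theorem inv_two_mul_goldenRatio_cube :
    1 / (2 * Real.goldenRatio ^ 3) = 1 / 2 - 1 / Real.goldenRatio ^ 2 := by
  rw [inv_goldenRatio_sq,
    div_eq_iff (mul_ne_zero two_ne_zero (pow_ne_zero _ Real.goldenRatio_ne_zero))]
  linear_combination
    (-2 * Real.goldenRatio ^ 2 + Real.goldenRatio - 1) * Real.goldenRatio_sq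

theorem inducedTorusMap_goldenMap_eq_skew :
    inducedTorusMap goldenMap = skew ((1 / Real.goldenRatio ^ 2 : ℝ) : UnitAddCircle)
      ((1 / 2 - 1 / Real.goldenRatio ^ 2 : ℝ) : UnitAddCircle) := by
  funext z
  conv_lhs => rw [← toTorus_torusRep z]
  conv_rhs => rw [← toTorus_torusRep z]
  rw [inducedTorusMap_goldenMap, ← inv_two_mul_goldenRatio_cube]
  rfl

theorem ergodic_inducedTorusMap_goldenMap : Ergodic (inducedTorusMap goldenMap) := by
  rw [inducedTorusMap_goldenMap_eq_skew]
  refine ergodic_skew fun n hn h => ?_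
  rw [← AddCircle.coe_zsmul, AddCircle.coe_eq_zero_iff] at h
  obtain ⟨k, hk⟩ := h
  rw [inv_goldenRatio_sq] at hk
  simp only [zsmul_eq_mul, mul_one] at hk
  refine (Real.goldenRatio_irrational.intCast_mul hn).ne_int (2 * n - k) ?_
  push_cast
  linarith

/-- An exchange obtained from a bounded choice of representatives is conjugate to the golden map. -/
theorem TorusLift.conjugateTo_goldenMap {m : ℕ} (L : TorusLift goldenMap m) {C : ℝ}
    (h₁ : ∀ z, (L.rep z).1 ≤ C) (h₂ : ∀ z, (L.rep z).2 ≤ C) :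
    L.exchange.ConjugateTo goldenMap := by
  have herg := ergodic_inducedTorusMap_goldenMap
  have hm₁ : Measurable fun z => (L.rep z).1 := measurable_fst.comp L.measurable_rep
  have hm₂ : Measurable fun z => (L.rep z).2 := measurable_snd.comp L.measurable_rep
  obtain ⟨s₁, hs₁⟩ := exists_ae_iSup_iterate_eq herg hm₁ h₁
  obtain ⟨s₂, hs₂⟩ := exists_ae_iSup_iterate_eq herg hm₂ h₂
  set T := inducedTorusMap goldenMap with hT
  refine L.exchange_conjugateTo herg.toMeasurePreserving
    (Z := {z | ⨆ n : ℕ, (L.rep (T^[n] z)).1 = s₁} ∩ {z | ⨆ n : ℕ, (L.rep (T^[n] z)).2 = s₂})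
    ((measurableSet_eq_fun (Measurable.iSup fun n => hm₁.comp (herg.measurable.iterate n))
      measurable_const).inter (measurableSet_eq_fun (Measurable.iSup fun n =>
        hm₂.comp (herg.measurable.iterate n)) measurable_const)) (hs₁.and hs₂) ?_
  intro z hz w hw hzw
  have hstep : ∀ n v, L.rep (T^[n + 1] v) =
      goldenMap (L.rep (T^[n] v)) - intVec (L.vec (L.torusCoding v n)) := fun n v => by
    rw [Function.iterate_succ_apply', hT, L.rep_step]; rfl
  -- Equal codings give equal translations at each step, so the difference of first coordinates
  -- never changes.
  have hfst : ∀ n, (L.rep (T^[n] w)).1 = (L.rep (T^[n] z)).1 + ((L.rep w).1 - (L.rep z).1) := by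
    intro n
    induction n with
    | zero => simp
    | succ n ih =>
      rw [hstep, hstep, hzw]
      simp only [Prod.fst_sub, goldenMap, ih]
      ring
  have hd : (L.rep w).1 - (L.rep z).1 = 0 := by
    refine eq_zero_of_iSup_add_eq (g := fun n => (L.rep (T^[n] z)).1)
      ⟨C, by rintro _ ⟨n, rfl⟩; exact h₁ _⟩ ?_
    simp_rw [← hfst]
    exact hw.1.trans hz.1.symm
  simp_rw [hd, add_zero] at hfst
  have hsnd : ∀ n, (L.rep (T^[n] w)).2 = (L.rep (T^[n] z)).2 + ((L.rep w).2 - (L.rep z).2) := by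
    intro n
    induction n with
    | zero => simp
    | succ n ih =>
      rw [hstep, hstep, hzw]
      simp only [Prod.snd_sub, goldenMap, ih, hfst]
      ring
  have hd' : (L.rep w).2 - (L.rep z).2 = 0 := by
    refine eq_zero_of_iSup_add_eq (g := fun n => (L.rep (T^[n] z)).2)
      ⟨C, by rintro _ ⟨n, rfl⟩; exact h₂ _⟩ ?_
    simp_rw [← hsnd]
    exact hw.2.trans hz.2.symm
  rw [← L.toTorus_rep z, ← L.toTorus_rep w]
  exact congrArg toTorus (Prod.ext (by linarith) (by linarith))

/-! ### Convergents and the rotation between two visits -/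

/-- Two consecutive convergents `p / q < α < p' / q'` of `α`, with the estimates that bound by
`1 / 2` the centred Birkhoff sums of the rotation of angle `α` between two visits to the interval
`[-(p' - q' α), q α - p)`. -/
structure Convergents (α : ℝ) where
  /-- the denominator of the lower convergent -/
  q : ℕ
  /-- the denominator of the upper convergent -/
  q' : ℕ
  /-- the numerator of the lower convergent -/
  p : ℤ
  /-- the numerator of the upper convergent -/
  p' : ℤ
  det : p' * q - p * q' = 1
  two_le_q : 2 ≤ q
  q_lt_q' : q < q'
  upper_pos : 0 < p' - q' * α
  upper_le_lower : p' - q' * α ≤ q * α - p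
  lower_le : (q + 1) * (q * α - p) ≤ 1
  upper_le : (q' + 1) * (p' - q' * α) ≤ 1
  lower_le_upper : q' * (q * α - p) ≤ (q + q' + 1) * (p' - q' * α)

/-- The convergents of `1 / φ²` are quotients of Fibonacci numbers. -/
theorem exists_convergents_golden (M : ℕ) :
    ∃ D : Convergents (1 / Real.goldenRatio ^ 2), M < D.q := by
  rw [inv_goldenRatio_sq]
  have hsq := Real.goldenRatio_sq
  have h1 := Real.one_lt_goldenRatio
  have h2 := Real.goldenRatio_lt_two
  generalize Real.goldenRatio = φ at hsq h1 h2 ⊢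
  -- The induction advances by two Fibonacci indices, which keeps `p / q` on the lower side. The
  -- ratio of the two errors is exactly `φ`, and the remaining estimates follow from this.
  have key : ∀ l : ℕ, ∃ q q' p p' : ℕ, (p' * q : ℤ) - p * q' = 1 ∧ l < q ∧ q ≤ q' ∧
      q + p' = q' ∧ p + p' = q ∧ (l ≠ 0 → q < q') ∧ 0 < (p' - q' * (2 - φ) : ℝ) ∧
      (p' - q' * (2 - φ) : ℝ) ≤ 1 ∧ (q * (2 - φ) - p : ℝ) = φ * (p' - q' * (2 - φ)) := by
    intro l
    induction l with
    | zero =>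
      have h32 : 3 / 2 < φ := by nlinarith
      refine ⟨1, 2, 0, 1, by norm_num, by norm_num, by norm_num, by norm_num, by norm_num,
        by norm_num, ?_, ?_, ?_⟩ <;> push_cast
      · linarith
      · linarith
      · linear_combination -2 * hsq
    | succ l ih =>
      obtain ⟨q, q', p, p', hdet, hl, hq, hp, hp', -, hpos, hle, heq⟩ := ih
      refine ⟨q + q', q + 2 * q', p + p', p + 2 * p', ?_, by omega, by omega, by omega, by omega,
        by omega, ?_, ?_, ?_⟩
      · push_cast; linear_combination hdet
      · push_cast; nlinarith
      · push_cast; nlinarith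
      · push_cast
        linear_combination (1 + φ) * heq + (p' - q' * (2 - φ)) * hsq
  obtain ⟨q, q', p, p', hdet, hl, -, hp, -, hlt, hpos, hle, heq⟩ := key (M + 1)
  have hlt := hlt (by omega)
  have hdet' : (p' * q - p * q' : ℝ) = 1 := by exact_mod_cast hdet
  have hid : q * (p' - q' * (2 - φ)) + q' * (q * (2 - φ) - p) = 1 := by linear_combination hdet'
  have hltR : (q + 1 : ℝ) ≤ q' := by exact_mod_cast hlt
  have hqR : (1 : ℝ) ≤ q := by exact_mod_cast (by omega : 1 ≤ q)
  have hpR : (q + p' : ℝ) = q' := by exact_mod_cast hp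
  have hη : (0 : ℝ) < q * (2 - φ) - p := by rw [heq]; positivity
  refine ⟨⟨q, q', p, p', hdet, by omega, hlt, by exact_mod_cast hpos, ?_, ?_, ?_, ?_⟩, by
    change M < q; omega⟩ <;> push_cast
  · rw [heq]; nlinarith
  · nlinarith
  · rw [heq] at hid
    nlinarith [mul_pos (sub_pos.2 h1) hpos, mul_nonneg (sub_nonneg.2 hqR) hpos.le,
      mul_nonneg (by linarith : (0 : ℝ) ≤ q') (mul_pos (sub_pos.2 h1) hpos).le]
  · rw [heq]
    have : q' * φ ≤ (q + q' + 1 : ℝ) := by linarith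
    nlinarith

namespace Convergents

variable {α : ℝ} (D : Convergents α)

/-- The distance `q α - p` of `q α` to `ℤ`. -/
def lower : ℝ := D.q * α - D.p

/-- The distance `p' - q' α` of `q' α` to `ℤ`. -/
def upper : ℝ := D.p' - D.q' * α

theorem upper_pos' : 0 < D.upper := D.upper_pos

theorem upper_le_lower' : D.upper ≤ D.lower := D.upper_le_lower

theorem lower_pos : 0 < D.lower := D.upper_pos'.trans_le D.upper_le_lower'

theorem det_real : (D.p' * D.q - D.p * D.q' : ℝ) = 1 := by exact_mod_cast D.det

theorem q_mul_upper_add : D.q * D.upper + D.q' * D.lower = 1 := by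
  rw [upper, lower]; linear_combination D.det_real

theorem two_le_q_real : (2 : ℝ) ≤ D.q := by exact_mod_cast D.two_le_q

theorem q_add_one_le_real : (D.q + 1 : ℝ) ≤ D.q' := by exact_mod_cast D.q_lt_q'

theorem lower_add_upper_lt_one : D.lower + D.upper < 1 := by
  have := D.q_mul_upper_add
  have := D.two_le_q_real
  have := D.q_add_one_le_real
  have := D.lower_pos
  have := D.upper_pos'
  nlinarith

/-- The determinant is 1, so `(i, m) = a (q, p) + b (q', p')` with integers `a`, `b`, and `i α - m =
a lower - b upper`. The bounds on `i` force `a ≥ 1` if `b ≤ 0` and `a ≤ -1` if `b ≥ 1`. -/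
theorem gap {i m : ℤ} (hi : 0 < i) (hi' : i < D.q') :
    (D.lower ≤ i * α - m ∧ (i < D.q → D.lower + D.upper ≤ i * α - m)) ∨
      i * α - m ≤ -(D.lower + D.upper) := by
  obtain ⟨a, ha⟩ : ∃ a, a = D.p' * i - D.q' * m := ⟨_, rfl⟩
  obtain ⟨b, hb⟩ : ∃ b, b = D.q * m - D.p * i := ⟨_, rfl⟩
  have hab : a * D.q + b * D.q' = i := by rw [ha, hb]; linear_combination i * D.det
  have hm : a * D.p + b * D.p' = m := by rw [ha, hb]; linear_combination m * D.det
  have ht : (i * α - m : ℝ) = a * D.lower - b * D.upper := by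
    rw [← hab, ← hm, lower, upper]; push_cast; ring
  have hη := D.lower_pos
  have hη' := D.upper_pos'
  have hq : (0 : ℤ) < D.q := by have := D.two_le_q; omega
  have hq' : (0 : ℤ) < D.q' := hq.trans (by exact_mod_cast D.q_lt_q')
  rw [ht]
  rcases lt_trichotomy b 0 with h | h | h
  · left
    have h1 : 1 ≤ a := by by_contra! h'; nlinarith
    have h1' : (1 : ℝ) ≤ a := by exact_mod_cast h1
    have h2' : (b : ℝ) ≤ -1 := by exact_mod_cast (by omega : b ≤ -1)
    exact ⟨by nlinarith, fun _ => by nlinarith⟩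
  · left
    subst h
    have h1 : 1 ≤ a := by by_contra! h'; nlinarith
    have h1' : (1 : ℝ) ≤ a := by exact_mod_cast h1
    refine ⟨by push_cast; nlinarith, fun h' => ?_⟩
    exfalso
    nlinarith
  · right
    have h1 : a ≤ -1 := by by_contra! h'; nlinarith
    have h1' : (a : ℝ) ≤ -1 := by exact_mod_cast h1
    have h2' : (1 : ℝ) ≤ b := by exact_mod_cast (by omega : 1 ≤ b)
    nlinarith

theorem fract_bounds {i : ℕ} (hi : 0 < i) (hi' : i < D.q') :
    D.lower ≤ Int.fract (i * α) ∧ Int.fract (i * α) ≤ 1 - (D.lower + D.upper) ∧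
      (i < D.q → D.lower + D.upper ≤ Int.fract (i * α)) := by
  have hi0 : (0 : ℤ) < i := by exact_mod_cast hi
  have hi1 : (i : ℤ) < D.q' := by exact_mod_cast hi'
  have h1 := D.gap (m := ⌊i * α⌋) hi0 hi1
  have h2 := D.gap (m := ⌊i * α⌋ + 1) hi0 hi1
  have h3 : (i * α - ⌊i * α⌋ : ℝ) = Int.fract (i * α) := rfl
  have hη := D.lower_pos
  have hη' := D.upper_pos'
  have h4 := Int.fract_nonneg (i * α)
  have h5 := Int.fract_lt_one (i * α)
  push_cast at h1 h2
  rw [← sub_sub, h3] at h2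
  rw [h3] at h1
  have h6 := h1.resolve_right (by linarith)
  refine ⟨h6.1, ?_, fun h => h6.2 (by exact_mod_cast h)⟩
  have h7 := h2.resolve_left fun h => by linarith [h.1]
  linarith

/-- This symmetry, like `fract_upper`, pairs `i` with the reflected index, so the fractional parts
along an excursion sum in closed form. -/
theorem fract_lower {i : ℕ} (hi : 0 < i) (hi' : i < D.q) :
    Int.fract (((D.q - i : ℕ) : ℝ) * α) = 1 + D.lower - Int.fract (i * α) := by
  obtain ⟨h1, h2, h3⟩ := D.fract_bounds hi (hi'.trans D.q_lt_q')
  have := D.upper_pos'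
  have := D.lower_pos
  have := h3 hi'
  rw [Int.fract_eq_iff]
  refine ⟨by linarith, by linarith, D.p - 1 - ⌊i * α⌋, ?_⟩
  rw [lower, Int.fract, Nat.cast_sub hi'.le]
  push_cast
  ring

theorem fract_upper {i : ℕ} (hi : 0 < i) (hi' : i < D.q') :
    Int.fract (((D.q' - i : ℕ) : ℝ) * α) = 1 - D.upper - Int.fract (i * α) := by
  obtain ⟨h1, h2, h3⟩ := D.fract_bounds hi hi'
  have := D.upper_pos'
  have := D.lower_pos
  rw [Int.fract_eq_iff]
  refine ⟨by linarith, by linarith, D.p' - 1 - ⌊i * α⌋, ?_⟩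
  rw [upper, Int.fract, Nat.cast_sub hi'.le]
  push_cast
  ring

theorem sum_fract_of_reflect {n : ℕ} {s : ℝ} (hn : 0 < n)
    (h : ∀ i : ℕ, 0 < i → i < n → Int.fract (((n - i : ℕ) : ℝ) * α) = s - Int.fract (i * α)) :
    ∑ i ∈ Finset.range (n - 1), Int.fract (((i + 1 : ℕ) : ℝ) * α) = (n - 1) * s / 2 := by
  have h1 : ∑ i ∈ Finset.range (n - 1), Int.fract (((i + 1 : ℕ) : ℝ) * α) =
      ∑ i ∈ Finset.range (n - 1), (s - Int.fract (((i + 1 : ℕ) : ℝ) * α)) := by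
    rw [← Finset.sum_range_reflect]
    refine Finset.sum_congr rfl fun i hi => ?_
    rw [Finset.mem_range] at hi
    rw [← h (i + 1) (by omega) (by omega)]
    congr 4
    omega
  rw [Finset.sum_sub_distrib, Finset.sum_const, Finset.card_range, nsmul_eq_mul,
    Nat.cast_sub hn] at h1
  push_cast at h1 ⊢
  linarith

/-- The representative in `[-(p' - q' α), 1 - (p' - q' α))` of a point of the circle. -/
noncomputable def rho (x : UnitAddCircle) : ℝ := AddCircle.equivIco 1 (-D.upper) x

theorem rho_mem (x : UnitAddCircle) : D.rho x ∈ Ico (-D.upper) (-D.upper + 1) :=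
  Subtype.coe_prop _

theorem coe_rho (x : UnitAddCircle) : (D.rho x : UnitAddCircle) = x := AddCircle.coe_equivIco

theorem measurable_rho : Measurable D.rho :=
  measurable_subtype_coe.comp (AddCircle.measurableEquivIco 1 (-D.upper)).measurable

theorem rho_eq {x : UnitAddCircle} {r : ℝ} (hr : r ∈ Ico (-D.upper) (-D.upper + 1))
    (h : (r : UnitAddCircle) = x) : D.rho x = r := by
  rw [← h, rho, AddCircle.equivIco_coe_of_mem hr]

/-- Until its first return, a point of `[-(p' - q' α), q α - p)` is translated without
crossing the cut. -/
theorem rho_add_of_lt {x : UnitAddCircle} (hx : D.rho x < D.lower) {i : ℕ} (hi : 0 < i)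
    (hi' : i < D.q' ∧ (0 ≤ D.rho x ∨ i < D.q)) :
    D.rho (x + ((i * α : ℝ) : UnitAddCircle)) = D.rho x + Int.fract (i * α) ∧
      D.lower ≤ D.rho (x + ((i * α : ℝ) : UnitAddCircle)) := by
  obtain ⟨h1, h2, h3⟩ := D.fract_bounds hi hi'.1
  have h4 := (D.rho_mem x).1
  have h5 : D.lower ≤ D.rho x + Int.fract (i * α) := by
    rcases hi'.2 with h | h
    · linarith
    · linarith [h3 h]
  have h6 : D.rho (x + ((i * α : ℝ) : UnitAddCircle)) = D.rho x + Int.fract (i * α) := by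
    refine D.rho_eq ⟨by linarith [D.lower_pos, D.upper_pos'], by linarith⟩ ?_
    rw [AddCircle.coe_add, coe_rho]
    congr 1
    exact unitAddCircle_coe_eq_coe_iff.2 ⟨-⌊i * α⌋, by rw [Int.fract]; push_cast; ring⟩
  exact ⟨h6, h6.symm ▸ h5⟩

theorem rho_add_q {x : UnitAddCircle} (hx : D.rho x < 0) :
    D.rho (x + ((D.q * α : ℝ) : UnitAddCircle)) = D.rho x + D.lower := by
  have := D.rho_mem x
  refine D.rho_eq ⟨by linarith [this.1, D.lower_pos],
    by linarith [D.lower_add_upper_lt_one]⟩ ?_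
  rw [AddCircle.coe_add, coe_rho]
  congr 1
  exact unitAddCircle_coe_eq_coe_iff.2 ⟨-D.p, by rw [lower]; push_cast; ring⟩

theorem rho_add_q' {x : UnitAddCircle} (hx : 0 ≤ D.rho x) :
    D.rho (x + ((D.q' * α : ℝ) : UnitAddCircle)) = D.rho x - D.upper := by
  have := D.rho_mem x
  refine D.rho_eq ⟨by linarith, by linarith [this.2, D.upper_pos']⟩ ?_
  rw [sub_eq_add_neg, AddCircle.coe_add, coe_rho]
  congr 1
  exact unitAddCircle_coe_eq_coe_iff.2 ⟨-D.p', by rw [upper]; push_cast; ring⟩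

/-- The first return time to `[-(p' - q' α), q α - p)`. -/
theorem first_return {x : UnitAddCircle} (hx : D.rho x < D.lower) {i : ℕ} (hi : 0 < i)
    (hvis : D.rho (x + ((i * α : ℝ) : UnitAddCircle)) < D.lower)
    (hno : ∀ k : ℕ, 0 < k → k < i → D.lower ≤ D.rho (x + ((k * α : ℝ) : UnitAddCircle))) :
    (D.rho x < 0 ∧ i = D.q) ∨ (0 ≤ D.rho x ∧ i = D.q') := by
  have hq := D.two_le_q
  have hqq := D.q_lt_q'
  rcases lt_or_ge (D.rho x) 0 with h | h
  · refine Or.inl ⟨h, ?_⟩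
    rcases lt_trichotomy i D.q with h' | h' | h'
    · exact absurd hvis (not_lt.2 (D.rho_add_of_lt hx hi ⟨by omega, Or.inr h'⟩).2)
    · exact h'
    · have := hno D.q (by omega) h'
      rw [D.rho_add_q h] at this
      linarith
  · refine Or.inr ⟨h, ?_⟩
    rcases lt_trichotomy i D.q' with h' | h' | h'
    · exact absurd hvis (not_lt.2 (D.rho_add_of_lt hx hi ⟨h', Or.inl h⟩).2)
    · exact h'
    · have := hno D.q' (by omega) h'
      rw [D.rho_add_q' h] at this
      linarith [D.upper_pos']

/-- Going back by `q` steps lowers the representative by `lower`; enough such moves bring it into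
`[-upper, lower)`. -/
theorem exists_visit (x : UnitAddCircle) :
    ∃ j : ℕ, D.rho (x - ((j * α : ℝ) : UnitAddCircle)) < D.lower := by
  have hη := D.lower_pos
  have h0 : 0 ≤ (D.rho x + D.upper) / D.lower :=
    div_nonneg (by linarith [(D.rho_mem x).1]) hη.le
  set k := ⌊(D.rho x + D.upper) / D.lower⌋₊
  have h1 : k * D.lower ≤ D.rho x + D.upper := (le_div_iff₀ hη).1 (Nat.floor_le h0)
  have h2 : D.rho x + D.upper < (k + 1) * D.lower := (div_lt_iff₀ hη).1 (Nat.lt_floor_add_one _)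
  have h3 := D.upper_pos'
  have h4 : D.rho (x - (((k * D.q : ℕ) * α : ℝ) : UnitAddCircle)) = D.rho x - k * D.lower := by
    refine D.rho_eq ⟨by linarith, by linarith [D.lower_add_upper_lt_one]⟩ ?_
    rw [AddCircle.coe_sub, coe_rho]
    congr 1
    exact unitAddCircle_coe_eq_coe_iff.2 ⟨-k * D.p, by rw [lower]; push_cast; ring⟩
  exact ⟨k * D.q, by rw [h4]; linarith⟩

open Classical in
/-- The time elapsed since the last visit to `[-(p' - q' α), q α - p)`. -/
noncomputable def age (x : UnitAddCircle) : ℕ := Nat.find (D.exists_visit x)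

theorem age_spec (x : UnitAddCircle) : D.rho (x - ((D.age x * α : ℝ) : UnitAddCircle)) < D.lower :=
  Nat.find_spec (D.exists_visit x)

theorem le_rho_of_lt_age {x : UnitAddCircle} {j : ℕ} (hj : j < D.age x) :
    D.lower ≤ D.rho (x - ((j * α : ℝ) : UnitAddCircle)) :=
  not_lt.1 (Nat.find_min (D.exists_visit x) hj)

theorem age_eq_zero {x : UnitAddCircle} (hx : D.rho x < D.lower) : D.age x = 0 :=
  (Nat.find_eq_zero _).2 (by simpa using hx)

theorem age_add {x : UnitAddCircle} (hx : D.lower ≤ D.rho (x + (α : UnitAddCircle))) :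
    D.age (x + (α : UnitAddCircle)) = D.age x + 1 := by
  have hs : ∀ j : ℕ, x + (α : UnitAddCircle) - (((j + 1 : ℕ) * α : ℝ) : UnitAddCircle) =
      x - ((j * α : ℝ) : UnitAddCircle) := fun j => by
    rw [Nat.cast_succ, add_mul, one_mul, AddCircle.coe_add]; abel
  rw [age, Nat.find_eq_iff]
  refine ⟨by rw [hs]; exact D.age_spec x, fun j hj => ?_⟩
  cases j with
  | zero => simpa using hx
  | succ j => rw [hs, not_lt]; exact D.le_rho_of_lt_age (by omega)

theorem age_lt (x : UnitAddCircle) : D.age x < D.q' := by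
  by_contra! h
  have hq := D.two_le_q
  have hqq := D.q_lt_q'
  have hb := D.age_spec x
  set b := x - ((D.age x * α : ℝ) : UnitAddCircle)
  have hno : ∀ i : ℕ, 0 < i → i ≤ D.age x →
      D.lower ≤ D.rho (b + ((i * α : ℝ) : UnitAddCircle)) := by
    intro i hi hi'
    have := D.le_rho_of_lt_age (x := x) (j := D.age x - i) (by omega)
    rw [Nat.cast_sub hi', sub_mul, AddCircle.coe_sub] at this
    convert this using 2
    simp only [b]
    abel
  rcases lt_or_ge (D.rho b) 0 with h' | h'
  · have := hno D.q (by omega) (by omega)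
    rw [D.rho_add_q h'] at this
    linarith
  · have := hno D.q' (by omega) h
    rw [D.rho_add_q' h'] at this
    linarith [D.upper_pos']

end Convergents

/-! ### The representatives, raised at visits -/

/-- The inverse of `skew a c`. -/
def unskew (a c : UnitAddCircle) (p : Torus) : Torus := (p.1 - a, p.2 - (p.1 - a) + c)

theorem unskew_skew (a c : UnitAddCircle) (p : Torus) : unskew a c (skew a c p) = p := by
  refine Prod.ext ?_ ?_ <;> simp only [unskew, skew] <;> abel

theorem skew_unskew (a c : UnitAddCircle) (p : Torus) : skew a c (unskew a c p) = p := by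
  refine Prod.ext ?_ ?_ <;> simp only [unskew, skew] <;> abel

theorem measurable_unskew (a c : UnitAddCircle) : Measurable (unskew a c) := by
  unfold unskew; fun_prop

theorem skew_iterate_fst (a : ℝ) (c : UnitAddCircle) (n : ℕ) (p : Torus) :
    ((skew a c)^[n] p).1 = p.1 + ((n * a : ℝ) : UnitAddCircle) := by
  induction n with
  | zero => simp
  | succ n ih =>
    rw [Function.iterate_succ_apply', skew, ih, Nat.cast_succ, add_mul, one_mul, AddCircle.coe_add,
      add_assoc]

/-- The representative in `[0, 1)` of `y + 1 / 2`. -/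
noncomputable def halfRep (y : UnitAddCircle) : ℝ :=
  AddCircle.equivIco 1 0 (y + ((1 / 2 : ℝ) : UnitAddCircle))

theorem halfRep_mem (y : UnitAddCircle) : halfRep y ∈ Ico (0 : ℝ) 1 := by
  have := Subtype.coe_prop (AddCircle.equivIco (1 : ℝ) 0 (y + ((1 / 2 : ℝ) : UnitAddCircle)))
  exact ⟨this.1, this.2.trans_eq (zero_add 1)⟩

theorem coe_halfRep (y : UnitAddCircle) :
    (halfRep y : UnitAddCircle) = y + ((1 / 2 : ℝ) : UnitAddCircle) := AddCircle.coe_equivIco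

theorem measurable_halfRep : Measurable halfRep :=
  (measurable_subtype_coe.comp (AddCircle.measurableEquivIco 1 0).measurable).comp
    (measurable_id.add_const _)

theorem halfRep_eq {y : UnitAddCircle} {r : ℝ} (hr : r ∈ Ico (0 : ℝ) 1)
    (h : (r : UnitAddCircle) = y + ((1 / 2 : ℝ) : UnitAddCircle)) : halfRep y = r := by
  rw [halfRep, ← h, AddCircle.equivIco_coe_of_mem (by rwa [zero_add])]

namespace Convergents

variable {α : ℝ} (D : Convergents α)

/-- The sum of the centred rotation along an excursion out of `[-(p' - q' α), q α - p)`, as a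
function of the starting point. -/
noncomputable def excursion (r : ℝ) : ℝ :=
  if r < 0 then D.q * r + D.lower * (D.q + 1) / 2 else D.q' * r - D.upper * (D.q' + 1) / 2

/-- The function is increasing and affine on each side of 0, so only the ends of the two pieces
matter. With `q upper + q' lower = 1`, the four end conditions follow from `upper_le_lower`,
`lower_le`, `upper_le` and `lower_le_upper`. -/
theorem excursion_mem {r : ℝ} (h : -D.upper ≤ r) (h' : r < D.lower) :
    D.excursion r ∈ Icc (-(1 / 2) : ℝ) (1 / 2) := by
  have h1 := D.q_mul_upper_add
  have h2 := D.two_le_q_real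
  have h3 := D.q_add_one_le_real
  have h4 := D.lower_pos
  have h5 := D.upper_pos'
  have h6 := D.upper_le_lower'
  have h7 : (D.q + 1) * D.lower ≤ 1 := D.lower_le
  have h8 : (D.q' + 1) * D.upper ≤ 1 := D.upper_le
  have h9 : D.q' * D.lower ≤ (D.q + D.q' + 1) * D.upper := D.lower_le_upper
  rw [excursion]
  split_ifs with hr
  · constructor
    · have : D.q * -D.upper ≤ D.q * r := mul_le_mul_of_nonneg_left h (by linarith)
      nlinarith
    · have : D.q * r ≤ 0 := mul_nonpos_of_nonneg_of_nonpos (by linarith) hr.le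
      linarith
  · rw [not_lt] at hr
    constructor
    · have : 0 ≤ D.q' * r := mul_nonneg (by linarith) hr
      linarith
    · have : D.q' * r ≤ D.q' * D.lower := mul_le_mul_of_nonneg_left h'.le (by linarith)
      linarith

theorem measurable_excursion : Measurable D.excursion :=
  Measurable.ite measurableSet_Iio (by fun_prop) (by fun_prop)

open Classical in
/-- The unit by which the first coordinate of the representative is raised. -/
noncomputable def raise (z : Torus) : ℝ :=
  -- Unraised, the value brought to the next visit would be `halfRep + excursion - 1/2`, which lies
  -- in `[-1, 1)`; the unit is added exactly when this is negative.
  if D.rho z.1 < D.lower ∧ halfRep z.2 + D.excursion (D.rho z.1) < 1 / 2 then 1 else 0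

theorem raise_eq_zero_or_one (z : Torus) : D.raise z = 0 ∨ D.raise z = 1 := by
  rw [raise]; split_ifs <;> simp

theorem raise_eq_zero {z : Torus} (h : D.lower ≤ D.rho z.1) : D.raise z = 0 :=
  if_neg fun h' => not_lt.2 h h'.1

theorem measurable_raise : Measurable D.raise := by
  have h1 : Measurable fun z : Torus => D.rho z.1 := D.measurable_rho.comp measurable_fst
  refine Measurable.ite ((measurableSet_lt h1 measurable_const).inter (measurableSet_lt
    ((measurable_halfRep.comp measurable_snd).add (D.measurable_excursion.comp h1))
    measurable_const)) measurable_const measurable_const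

/-- The torus map, for the constant that makes the second increment centred. -/
noncomputable abbrev map : Torus → Torus := skew (α : UnitAddCircle) ((1 / 2 - α : ℝ) : UnitAddCircle)

/-- The inverse of the torus map. -/
noncomputable abbrev mapInv : Torus → Torus :=
  unskew (α : UnitAddCircle) ((1 / 2 - α : ℝ) : UnitAddCircle)

/-- The second coordinate of the representative of a point of given age. -/
noncomputable def height : ℕ → Torus → ℝ
  | 0, z => halfRep z.2 + D.raise z - 1 / 2
  | j + 1, z => height j (mapInv (α := α) z) + D.rho z.1 - 1 / 2

theorem measurable_height (j : ℕ) : Measurable (D.height j) := by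
  induction j with
  | zero =>
    exact ((measurable_halfRep.comp measurable_snd).add D.measurable_raise).sub_const _
  | succ j ih =>
    exact ((ih.comp (measurable_unskew _ _)).add (D.measurable_rho.comp measurable_fst)).sub_const _

theorem coe_raise (z : Torus) : (D.raise z : UnitAddCircle) = 0 := by
  rcases D.raise_eq_zero_or_one z with h | h <;> rw [h]
  · simp
  · exact AddCircle.coe_period 1

theorem coe_height (j : ℕ) (z : Torus) : (D.height j z : UnitAddCircle) = z.2 := by
  induction j generalizing z with
  | zero =>
    rw [height, AddCircle.coe_sub, AddCircle.coe_add, coe_halfRep, coe_raise]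
    abel
  | succ j ih =>
    rw [height, AddCircle.coe_sub, AddCircle.coe_add, ih, coe_rho]
    simp only [mapInv, unskew, AddCircle.coe_sub]
    abel

theorem height_iterate (j : ℕ) (z : Torus) :
    D.height j ((map (α := α))^[j] z) = halfRep z.2 + D.raise z - 1 / 2 +
      ∑ i ∈ Finset.range j,
        (D.rho (z.1 + (((i + 1 : ℕ) * α : ℝ) : UnitAddCircle)) - 1 / 2) := by
  induction j with
  | zero => simp [height]
  | succ j ih =>
    rw [height, Function.iterate_succ_apply', mapInv, unskew_skew, ih, Finset.sum_range_succ,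
      ← Function.iterate_succ_apply' (map (α := α)) j z, skew_iterate_fst]
    ring

/-- The first coordinate of the representative. -/
noncomputable def absc (z : Torus) : ℝ := D.rho z.1 + D.raise z

/-- The representative in the plane of a point of the torus. -/
noncomputable def rep (z : Torus) : Plane := (D.absc z, D.height (D.age z.1) z)

theorem toTorus_rep (z : Torus) : toTorus (D.rep z) = z := by
  refine Prod.ext ?_ (D.coe_height _ z)
  change ((D.rho z.1 + D.raise z : ℝ) : UnitAddCircle) = z.1
  rw [AddCircle.coe_add, coe_rho, coe_raise, add_zero]

theorem measurable_absc : Measurable D.absc :=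
  (D.measurable_rho.comp measurable_fst).add D.measurable_raise

theorem measurable_rep : Measurable D.rep := by
  classical
  refine D.measurable_absc.prodMk ?_
  have h : ∀ z : Torus, ∃ j : ℕ, D.rho (z.1 - ((j * α : ℝ) : UnitAddCircle)) < D.lower :=
    fun z => D.exists_visit z.1
  have := Measurable.find (f := fun j z => D.height j z) D.measurable_height
    (p := fun j z => D.rho (z.1 - ((j * α : ℝ) : UnitAddCircle)) < D.lower)
    (fun j => measurableSet_lt (D.measurable_rho.comp (measurable_fst.sub_const _))
      measurable_const) h
  convert this using 2 with z
  rw [age]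

theorem absc_mem (z : Torus) : D.absc z ∈ Ico (-D.upper) (1 + D.lower) := by
  have h := D.rho_mem z.1
  have := D.upper_pos'
  have := D.lower_pos
  rw [absc, raise]
  split_ifs with h'
  · exact ⟨by linarith [h.1], by linarith [h'.1]⟩
  · exact ⟨by linarith [h.1], by linarith [h.2]⟩

theorem absc_of_le {z : Torus} (h : D.lower ≤ D.rho z.1) : D.absc z = D.rho z.1 := by
  rw [absc, D.raise_eq_zero h, add_zero]

/-- The point of the last visit. -/
theorem exists_eq_iterate_age (z : Torus) : ∃ b : Torus, (map (α := α))^[D.age z.1] b = z ∧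
    b.1 = z.1 - ((D.age z.1 * α : ℝ) : UnitAddCircle) := by
  have hinv : Function.LeftInverse (map (α := α)) (mapInv (α := α)) := skew_unskew _ _
  refine ⟨(mapInv (α := α))^[D.age z.1] z, hinv.iterate _ z, ?_⟩
  have := skew_iterate_fst α ((1 / 2 - α : ℝ) : UnitAddCircle) (D.age z.1)
    ((mapInv (α := α))^[D.age z.1] z)
  rw [hinv.iterate _ z] at this
  exact eq_sub_of_add_eq this.symm

/-- On returning to `[-(p' - q' α), q α - p)` the second coordinates match. -/
theorem halfRep_map_of_visit {z : Torus} (h : D.rho (z.1 + (α : UnitAddCircle)) < D.lower) :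
    halfRep (map (α := α) z).2 =
      D.height (D.age z.1) z + D.rho (z.1 + (α : UnitAddCircle)) := by
  have hq := D.two_le_q
  have hqq := D.q_lt_q'
  obtain ⟨b, hbz, hb1⟩ := D.exists_eq_iterate_age z
  have hb := D.age_spec z.1
  rw [← hb1] at hb
  have hshift : ∀ k : ℕ, k ≤ D.age z.1 → b.1 + ((k * α : ℝ) : UnitAddCircle) =
      z.1 - (((D.age z.1 - k : ℕ) * α : ℝ) : UnitAddCircle) := by
    intro k hk
    rw [hb1, Nat.cast_sub hk, sub_mul, AddCircle.coe_sub]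
    abel
  have hlast : b.1 + (((D.age z.1 + 1 : ℕ) * α : ℝ) : UnitAddCircle) =
      z.1 + (α : UnitAddCircle) := by
    rw [hb1, Nat.cast_succ, add_mul, one_mul, AddCircle.coe_add]
    abel
  -- No visit occurs strictly between `b` and the image of `z`, so `age + 1` is the return time of
  -- `b`: `q` or `q'`.
  have hret := D.first_return hb (Nat.add_one_pos (D.age z.1)) (hlast.symm ▸ h) fun k hk hk' => by
    rw [hshift k (by omega)]
    exact D.le_rho_of_lt_age (by omega)
  have hsum : ∀ n : ℕ, 0 < n → (∀ i : ℕ, 0 < i → i < n → i < D.q' ∧ (0 ≤ D.rho b.1 ∨ i < D.q)) →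
      ∀ s : ℝ, (∀ i : ℕ, 0 < i → i < n →
        Int.fract (((n - i : ℕ) : ℝ) * α) = s - Int.fract (i * α)) →
      D.age z.1 = n - 1 → D.height (D.age z.1) z =
        halfRep b.2 + D.raise b - 1 / 2 + (n - 1) * (D.rho b.1 + s / 2 - 1 / 2) := by
    intro n hn hlt s hs hage
    have h0 := D.height_iterate (D.age z.1) b
    rw [hbz] at h0
    rw [h0, hage]
    congr 1
    have h1 : ∀ i ∈ Finset.range (n - 1),
        D.rho (b.1 + (((i + 1 : ℕ) * α : ℝ) : UnitAddCircle)) - 1 / 2 =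
          (D.rho b.1 - 1 / 2) + Int.fract (((i + 1 : ℕ) : ℝ) * α) := by
      intro i hi
      rw [Finset.mem_range] at hi
      rw [(D.rho_add_of_lt hb (Nat.succ_pos i) (hlt (i + 1) (by omega) (by omega))).1]
      ring
    rw [Finset.sum_congr rfl h1, Finset.sum_add_distrib, sum_fract_of_reflect hn hs,
      Finset.sum_const, Finset.card_range, nsmul_eq_mul, Nat.cast_sub hn]
    push_cast
    ring
  have hval : D.height (D.age z.1) z + D.rho (z.1 + (α : UnitAddCircle)) =
      halfRep b.2 + D.excursion (D.rho b.1) - 1 / 2 + D.raise b := by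
    rw [← hlast]
    rcases hret with ⟨hneg, hage⟩ | ⟨hpos, hage⟩
    · rw [hsum D.q (by omega) (fun i hi hi' => ⟨by omega, Or.inr hi'⟩) (1 + D.lower)
        (fun i hi hi' => D.fract_lower hi hi') (by omega), hage, D.rho_add_q hneg, excursion,
        if_pos hneg]
      ring
    · rw [hsum D.q' (by omega) (fun i hi hi' => ⟨hi', Or.inl hpos⟩) (1 - D.upper)
        (fun i hi hi' => D.fract_upper hi hi') (by omega), hage, D.rho_add_q' hpos, excursion,
        if_neg (not_lt.2 hpos)]
      ring
  -- The right-hand side has the correct class modulo 1, and the choice of `raise` puts it in `[0,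
  -- 1)`.
  refine halfRep_eq ?_ ?_
  · rw [hval]
    have h1 := D.excursion_mem (D.rho_mem b.1).1 hb
    have h2 := halfRep_mem b.2
    rw [raise]
    split_ifs with h3
    · exact ⟨by linarith [h1.1, h2.1], by linarith [h3.2]⟩
    · have h4 : 1 / 2 ≤ halfRep b.2 + D.excursion (D.rho b.1) := by
        by_contra! h4
        exact h3 ⟨hb, h4⟩
      exact ⟨by linarith, by linarith [h1.2, h2.2]⟩
  · rw [AddCircle.coe_add, coe_height, coe_rho]
    simp only [map, skew, AddCircle.coe_sub]
    abel

/-- Away from visits this is the recursion defining `height`; at a visit, where `height` restarts,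
it is `halfRep_map_of_visit`. -/
theorem height_step (z : Torus) : D.height (D.age (map (α := α) z).1) (map (α := α) z) =
    D.height (D.age z.1) z + D.absc (map (α := α) z) - 1 / 2 := by
  have h1 : (map (α := α) z).1 = z.1 + (α : UnitAddCircle) := rfl
  rcases lt_or_ge (D.rho (z.1 + (α : UnitAddCircle))) D.lower with h | h
  · rw [absc, h1, D.age_eq_zero h, height, D.halfRep_map_of_visit h]
    ring
  · rw [D.absc_of_le (h1 ▸ h), h1, D.age_add h, height, mapInv, unskew_skew, h1]

/-- Because `q ≥ 2`, a visit is never followed at once by another. Entering a visit, `rho`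
necessarily loses 1, and a raise gives it back; leaving one, `rho` loses nothing, and only the raise
is removed. Hence two digits suffice. -/
theorem absc_step (hα : 0 < α) (hα' : α < 1) (z : Torus) : D.absc (map (α := α) z) = D.absc z + α ∨
    D.absc (map (α := α) z) = D.absc z + α - 1 := by
  have h1 : (map (α := α) z).1 = z.1 + (α : UnitAddCircle) := rfl
  have hq := D.two_le_q
  have hqq := D.q_lt_q'
  rcases lt_or_ge (D.rho z.1) D.lower with h | h
  · obtain ⟨h2, h3⟩ := D.rho_add_of_lt h one_pos ⟨by omega, Or.inr (by omega)⟩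
    rw [Nat.cast_one, one_mul] at h2 h3
    rw [Int.fract_eq_self.2 ⟨hα.le, hα'⟩] at h2
    rw [D.absc_of_le (h1 ▸ h3), h1, h2, absc]
    rcases D.raise_eq_zero_or_one z with h4 | h4 <;> rw [h4]
    · left; ring
    · right; ring
  · obtain ⟨n, hn⟩ : ∃ n : ℤ, D.rho z.1 + α - D.rho (z.1 + (α : UnitAddCircle)) = n := by
      rw [← unitAddCircle_coe_eq_coe_iff, AddCircle.coe_add, coe_rho, coe_rho]
    have h2 := D.rho_mem z.1
    have h3 := D.rho_mem (z.1 + (α : UnitAddCircle))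
    have h4 : -1 < n := by
      have : (-1 : ℝ) < n := by linarith [h2.1, h3.2]
      exact_mod_cast this
    have h5 : n < 2 := by
      have : (n : ℝ) < 2 := by linarith [h2.2, h3.1]
      exact_mod_cast this
    rw [D.absc_of_le h, absc, h1]
    rcases lt_or_ge (D.rho (z.1 + (α : UnitAddCircle))) D.lower with h6 | h6
    · have h7 : 0 < n := by
        have : (0 : ℝ) < n := by linarith
        exact_mod_cast this
      obtain rfl : n = 1 := by omega
      push_cast at hn
      rcases D.raise_eq_zero_or_one (map (α := α) z) with h8 | h8 <;> rw [h8]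
      · right; linarith
      · left; linarith
    · rw [D.raise_eq_zero (h1 ▸ h6)]
      obtain rfl | rfl : n = 0 ∨ n = 1 := by omega
      · left; push_cast at hn; linarith
      · right; push_cast at hn; linarith

open Classical in
/-- The integer part lost by the first coordinate. -/
noncomputable def digit (z : Torus) : Fin 2 :=
  if D.absc (map (α := α) z) = D.absc z + α then 0 else 1

theorem measurable_digit : Measurable D.digit :=
  Measurable.ite (measurableSet_eq_fun (D.measurable_absc.comp (measurable_skew _ _))
    (D.measurable_absc.add_const _)) measurable_const measurable_const

theorem absc_map (hα : 0 < α) (hα' : α < 1) (z : Torus) :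
    D.absc (map (α := α) z) = D.absc z + α - ((D.digit z : ℕ) : ℝ) := by
  rw [digit]
  split_ifs with h
  · simpa using h
  · simpa using (D.absc_step hα hα' z).resolve_left h

theorem height_le (z : Torus) : D.height (D.age z.1) z ≤ 2 + D.q' := by
  obtain ⟨b, hbz, -⟩ := D.exists_eq_iterate_age z
  have h1 : ∀ i ∈ Finset.range (D.age z.1),
      D.rho (b.1 + (((i + 1 : ℕ) * α : ℝ) : UnitAddCircle)) - 1 / 2 ≤ 1 := fun i _ => by
    linarith [(D.rho_mem (b.1 + (((i + 1 : ℕ) * α : ℝ) : UnitAddCircle))).2, D.upper_pos']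
  have h2 := Finset.sum_le_sum h1
  have h3 : (D.age z.1 : ℝ) ≤ D.q' := by exact_mod_cast (D.age_lt z.1).le
  have h4 := (halfRep_mem b.2).2
  rw [Finset.sum_const, Finset.card_range, nsmul_eq_mul, mul_one] at h2
  have h5 := D.height_iterate (D.age z.1) b
  rw [hbz] at h5
  rw [h5]
  rcases D.raise_eq_zero_or_one b with h | h <;> rw [h] <;> linarith

end Convergents

/-! ### Counting the words of a rotation -/

/-- The word of length `k` coded by the set `G` of the indices at which `t + i α` exceeds the next
integer after `i α`. -/
noncomputable def carryWord (α : ℝ) (k : ℕ) (G : Finset ℕ) (i : Fin k) : Fin 2 :=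
  if (⌊((i + 1 : ℕ) : ℝ) * α⌋ + if (i + 1 : ℕ) ∈ G then 1 else 0) =
    ⌊((i : ℕ) : ℝ) * α⌋ + if (i : ℕ) ∈ G then 1 else 0 then 0 else 1

/-- The indices `i ≤ k` at which `t + i α` exceeds the next integer after `i α`. -/
noncomputable def carrySet (α : ℝ) (k : ℕ) (t : ℝ) : Finset ℕ :=
  {i ∈ Finset.range (k + 1) | 1 ≤ t + Int.fract ((i : ℝ) * α)}

theorem floor_add_mul_eq {α t : ℝ} {k i : ℕ} (hi : i ≤ k) (ht : t ∈ Ico (0 : ℝ) 1) :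
    ⌊t + i * α⌋ = ⌊(i : ℝ) * α⌋ + if i ∈ carrySet α k t then 1 else 0 := by
  have h1 := Int.fract_nonneg ((i : ℝ) * α)
  have h2 := Int.fract_lt_one ((i : ℝ) * α)
  have h3 := Int.floor_add_fract ((i : ℝ) * α)
  have hmem : i ∈ carrySet α k t ↔ 1 ≤ t + Int.fract ((i : ℝ) * α) := by
    simp [carrySet, Nat.lt_succ_of_le hi]
  rw [Int.floor_eq_iff]
  split_ifs with h <;> rw [hmem] at h <;> push_cast
  · exact ⟨by linarith, by linarith [ht.2]⟩
  · exact ⟨by linarith [ht.1], by linarith⟩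

/-- There are at most `k + 1` words of length `k` that code rotations of angle `α`. -/
theorem ncard_le_of_carryWord {α : ℝ} {k : ℕ} {W : Set (Fin k → Fin 2)}
    (hW : ∀ w ∈ W, ∃ t ∈ Ico (0 : ℝ) 1, w = carryWord α k (carrySet α k t)) :
    W.ncard ≤ k + 1 := by
  have hsub : W ⊆ carryWord α k '' (carrySet α k '' Ico 0 1) := by
    intro w hw
    obtain ⟨t, ht, rfl⟩ := hW w hw
    exact mem_image_of_mem _ (mem_image_of_mem _ ht)
  have hmaps : ∀ G ∈ carrySet α k '' Ico 0 1, G.card ∈ (Finset.range (k + 1) : Set ℕ) := by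
    rintro _ ⟨t, ht, rfl⟩
    rw [Finset.coe_range, mem_Iio]
    -- Index 0 never carries since `t < 1`, so the cardinality is at most `k`.
    refine lt_of_lt_of_eq (Finset.card_lt_card ?_) (Finset.card_range (k + 1))
    rw [carrySet, Finset.filter_ssubset]
    exact ⟨0, by simp, by simpa using ht.2⟩
  have hmono : ∀ t t', t ≤ t' → carrySet α k t ⊆ carrySet α k t' := by
    intro t t' h i hi
    rw [carrySet, Finset.mem_filter] at hi ⊢
    exact ⟨hi.1, by linarith [hi.2]⟩
  -- The carry sets grow with `t`, so they form a chain and are determined by their cardinality.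
  have hinj : InjOn Finset.card (carrySet α k '' Ico 0 1) := by
    rintro _ ⟨t, -, rfl⟩ _ ⟨t', -, rfl⟩ h
    rcases le_total t t' with h' | h'
    · exact Finset.eq_of_subset_of_card_le (hmono _ _ h') h.ge
    · exact (Finset.eq_of_subset_of_card_le (hmono _ _ h') h.le).symm
  have hfin : (carrySet α k '' Ico 0 1).Finite :=
    Finite.of_injOn hmaps hinj (Finset.finite_toSet _)
  calc W.ncard ≤ (carryWord α k '' (carrySet α k '' Ico 0 1)).ncard :=
        ncard_le_ncard hsub (hfin.image _)
    _ ≤ (carrySet α k '' Ico 0 1).ncard := ncard_image_le hfin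
    _ ≤ (Finset.range (k + 1) : Set ℕ).ncard :=
        ncard_le_ncard_of_injOn _ hmaps hinj (Finset.finite_toSet _)
    _ = k + 1 := by rw [ncard_coe_finset, Finset.card_range]

/-- A word that records the integer parts lost by a sequence of real numbers of increments
`α` and `α - 1` codes a rotation, when the sequence stays in an interval of length `1`. -/
theorem eq_carryWord {α : ℝ} {k : ℕ} {X : ℕ → ℝ} {w : Fin k → Fin 2} {s : ℝ}
    (hX : ∀ i : Fin k, X (i + 1) = X i + α - ((w i : ℕ) : ℝ))
    (hs : ∀ i ≤ k, X i + s ∈ Ico (0 : ℝ) 1) :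
    ∃ t ∈ Ico (0 : ℝ) 1, w = carryWord α k (carrySet α k t) := by
  refine ⟨X 0 + s, hs 0 (Nat.zero_le k), ?_⟩
  -- The digits are integers, so in the unit interval the sequence can only be the rotation orbit of
  -- its first term.
  have h : ∀ i ≤ k, X i + s = Int.fract (X 0 + s + i * α) := by
    intro i
    induction i with
    | zero => intro _; simpa using (Int.fract_eq_self.2 (hs 0 (Nat.zero_le k))).symm
    | succ i ih =>
      intro hi
      refine (Int.fract_eq_iff.2 ⟨(hs _ hi).1, (hs _ hi).2,
        ⌊X 0 + s + i * α⌋ + ((w ⟨i, hi⟩ : ℕ) : ℤ), ?_⟩).symm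
      have h1 := hX ⟨i, hi⟩
      have h2 := ih (by omega)
      simp only at h1
      rw [Int.fract] at h2
      push_cast
      linarith
  funext i
  have h1 := hX i
  have h2 := h i i.2.le
  have h3 := h (i + 1) i.2
  rw [Int.fract] at h2 h3
  have h4 : ⌊X 0 + s + ((i + 1 : ℕ) : ℝ) * α⌋ =
      ⌊X 0 + s + ((i : ℕ) : ℝ) * α⌋ + ((w i : ℕ) : ℤ) := by
    have : (⌊X 0 + s + ((i + 1 : ℕ) : ℝ) * α⌋ : ℝ) =
      ⌊X 0 + s + ((i : ℕ) : ℝ) * α⌋ + ((w i : ℕ) : ℝ) := by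
      push_cast at h3 ⊢
      linarith
    exact_mod_cast this
  rw [floor_add_mul_eq i.2 (hs 0 (Nat.zero_le k)),
    floor_add_mul_eq i.2.le (hs 0 (Nat.zero_le k))] at h4
  rw [carryWord, h4]
  generalize w i = d
  fin_cases d <;> simp

namespace Convergents

variable {α : ℝ} (D : Convergents α)

/-- A value at or above `1 - upper` occurs only at a raised visit, and return times are at least `q
> k`. If there is one, every other point lies in `[lower, 1 - upper)` and `[lower, 1 + lower)`
contains all values; otherwise `[-upper, 1 - upper)` does. -/
theorem exists_shift_mem_Ico {k : ℕ} (hk : k < D.q) (z : Torus) :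
    ∃ s : ℝ, ∀ i ≤ k, D.absc ((map (α := α))^[i] z) + s ∈ Ico (0 : ℝ) 1 := by
  have hη := D.lower_pos
  have hη' := D.upper_pos'
  have hqq := D.q_lt_q'
  by_cases h : ∃ i ≤ k, 1 - D.upper ≤ D.absc ((map (α := α))^[i] z)
  · obtain ⟨i, hi, hi'⟩ := h
    have hvisit : ∀ j : ℕ, ¬ D.lower ≤ D.rho ((map (α := α))^[j] z).1 ∨
        D.absc ((map (α := α))^[j] z) ∈ Ico D.lower (1 - D.upper) := by
      intro j
      refine or_iff_not_imp_left.2 fun h => ?_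
      rw [not_not] at h
      rw [D.absc_of_le h]
      exact ⟨h, by linarith [(D.rho_mem ((map (α := α))^[j] z).1).2]⟩
    have hret : ∀ (j n : ℕ), 0 < n → n < D.q → D.rho ((map (α := α))^[j] z).1 < D.lower →
        D.lower ≤ D.rho ((map (α := α))^[n + j] z).1 := by
      intro j n hn hn' hj
      rw [Function.iterate_add_apply, skew_iterate_fst]
      exact (D.rho_add_of_lt hj hn ⟨by omega, Or.inr hn'⟩).2
    have hiv := (hvisit i).resolve_right fun h => not_lt.2 hi' h.2
    rw [not_le] at hiv
    refine ⟨-D.lower, fun j hj => ?_⟩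
    by_cases hij : j = i
    · subst hij
      have := D.absc_mem ((map (α := α))^[j] z)
      exact ⟨by linarith [D.lower_add_upper_lt_one], by linarith [this.2]⟩
    · have hj' : D.lower ≤ D.rho ((map (α := α))^[j] z).1 := by
        rcases lt_or_gt_of_ne hij with h | h
        · by_contra! h'
          have := hret j (i - j) (by omega) (by omega) h'
          rw [Nat.sub_add_cancel h.le] at this
          linarith
        · have := hret i (j - i) (by omega) (by omega) hiv
          rwa [Nat.sub_add_cancel h.le] at this
      have := (hvisit j).resolve_left (not_not.2 hj')
      exact ⟨by linarith [this.1], by linarith [this.2]⟩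
  · push Not at h
    refine ⟨D.upper, fun i hi => ?_⟩
    have := D.absc_mem ((map (α := α))^[i] z)
    exact ⟨by linarith [this.1], by linarith [h i hi]⟩

end Convergents

/-! ### The exchanges for the golden map -/

theorem inv_goldenRatio_sq_mem : 1 / Real.goldenRatio ^ 2 ∈ Ioo (0 : ℝ) 1 := by
  rw [inv_goldenRatio_sq]
  exact ⟨by linarith [Real.goldenRatio_lt_two], by linarith [Real.one_lt_goldenRatio]⟩

/-- The representatives associated with two convergents of `1 / φ²`. -/
noncomputable def goldenLift (D : Convergents (1 / Real.goldenRatio ^ 2)) :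
    TorusLift goldenMap 2 where
  rep := D.rep
  digit := D.digit
  -- The same integer serves both coordinates because the height increases by the new abscissa minus
  -- `1/2`.
  vec i := ((i : ℕ), (i : ℕ))
  measurable_rep := D.measurable_rep
  measurable_digit := D.measurable_digit
  toTorus_rep := D.toTorus_rep
  rep_step z := by
    have h := D.absc_map inv_goldenRatio_sq_mem.1 inv_goldenRatio_sq_mem.2 z
    rw [inducedTorusMap_goldenMap_eq_skew]
    refine Prod.ext ?_ ?_
    · exact h.trans (by simp [goldenMap, intVec, Convergents.rep])
    · refine (D.height_step z).trans ?_
      rw [h]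
      simp only [goldenMap, intVec, Convergents.rep, inv_two_mul_goldenRatio_cube, Prod.snd_sub,
        Int.cast_natCast]
      ring

theorem goldenLift_conjugateTo (D : Convergents (1 / Real.goldenRatio ^ 2)) :
    (goldenLift D).exchange.ConjugateTo goldenMap := by
  have h := D.lower_add_upper_lt_one
  have h' := D.upper_pos'
  refine (goldenLift D).conjugateTo_goldenMap (C := 2 + D.q') (fun z => ?_) D.height_le
  refine (D.absc_mem z).2.le.trans ?_
  have : (0 : ℝ) ≤ D.q' := Nat.cast_nonneg _
  linarith

theorem goldenLift_complexity_le (D : Convergents (1 / Real.goldenRatio ^ 2)) {k : ℕ}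
    (hk : k < D.q) : (goldenLift D).exchange.complexity k ≤ k + 1 := by
  rw [PieceExchange.complexity_eq_ncard_factors, TorusLift.exchange_codes]
  refine ncard_le_of_carryWord (α := 1 / Real.goldenRatio ^ 2) ?_
  rintro w ⟨_, ⟨z, rfl⟩, j, hw⟩
  obtain ⟨s, hs⟩ := D.exists_shift_mem_Ico hk
    ((Convergents.map (α := 1 / Real.goldenRatio ^ 2))^[j] z)
  refine eq_carryWord (X := fun i => D.absc ((Convergents.map (α := 1 / Real.goldenRatio ^ 2))^[i]
    ((Convergents.map (α := 1 / Real.goldenRatio ^ 2))^[j] z))) (fun i => ?_) hs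
  have hd : w i = D.digit ((Convergents.map (α := 1 / Real.goldenRatio ^ 2))^[i]
      ((Convergents.map (α := 1 / Real.goldenRatio ^ 2))^[j] z)) := by
    rw [hw i, ← Function.iterate_add_apply, add_comm j, TorusLift.torusCoding,
      inducedTorusMap_goldenMap_eq_skew]
    rfl
  simp only [Function.iterate_succ_apply']
  rw [hd]
  exact D.absc_map inv_goldenRatio_sq_mem.1 inv_goldenRatio_sq_mem.2 _

/-- There are exchanges of two pieces conjugate to the golden map with as many words as a Sturmian
sequence up to any given length. -/
theorem exists_conjugateTo_goldenMap (M : ℕ) : ∃ R : PieceExchange 2,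
    R.ConjugateTo goldenMap ∧ ∀ k ≤ M, R.complexity k = k + 1 := by
  obtain ⟨D, hD⟩ := exists_convergents_golden M
  have h := goldenLift_conjugateTo D
  exact ⟨_, h, fun k hk => le_antisymm (goldenLift_complexity_le D (hk.trans_lt hD))
    (h.lt_complexity k)⟩

end PlaneExchange

theorem mainTheorem2 :
    (∀ M : ℕ, ∃ R : PlaneExchange.PieceExchange 2,
      R.ConjugateTo PlaneExchange.goldenMap ∧
        ∀ k : ℕ, 1 ≤ k → k ≤ M → R.complexity k = k + 1) ∧
    ∀ n : ℕ, PlaneExchange.mapComplexity PlaneExchange.goldenMap n = n + 1 := by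
  refine ⟨fun M => ?_, fun n => ?_⟩
  · obtain ⟨R, hR, hk⟩ := PlaneExchange.exists_conjugateTo_goldenMap M
    exact ⟨R, hR, fun k _ => hk k⟩
  · obtain ⟨R, hR, hk⟩ := PlaneExchange.exists_conjugateTo_goldenMap n
    refine le_antisymm (Nat.sInf_le ⟨2, R, hR, hk n le_rfl⟩) (le_csInf ⟨_, 2, R, hR, rfl⟩ ?_)
    rintro _ ⟨m, E, hE, rfl⟩
    exact hE.lt_complexity n
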